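/- **Setting.** Let $Z\in\mathbb R^K$, $E\in\mathbb R^p$, $\varepsilon\in\mathbb R$ be independent, mean-zero, square-integrable random variables, with $\Sigma_Z=\operatorname{Cov}(Z)$, $\Sigma_E=\operatorname{Cov}(E)$, $\sigma_\varepsilon^2=\operatorname{Var}(\varepsilon)$. Let $A\in\mathbb R^{p\times K}$, $\beta\in\mathbb R^K$, and let $X=AZ+E$, $y=Z^\top\beta+\varepsilon$ (the factor regression model). The training data are built from $n$ i.i.d. copies $(Z_i,E_i,\varepsilon_i)$ of $(Z,E,\varepsilon)$, independent of the new observation $(Z,E,\varepsilon)$, by $X_i=AZ_i+E_i$, $y_i=Z_i^\top\beta+\varepsilon_i$. Write $\mathbf X\in\mathbb R^{n\times p}$, $\mathbf Z\in\mathbb R^{n\times K}$ for the matrices with rows $X_i$, $Z_i$, and $\mathbf y=(y_i)_i$, $\boldsymbol\varepsilon=(\varepsilon_i)_i$. Let $\widehat\alpha$ be the vector of smallest Euclidean norm among the minimizers of $u\mapsto\|\mathbf Xu-\mathbf y\|$, let $\widehat\beta=\mathbf Z^+\mathbf y$, where $\mathbf Z^+$ is the Moore–Penrose pseudo-inverse,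 and let $R(\alpha)=\mathbb E_{(X,y)}[(X^\top\alpha-y)^2]$, so that $R(\widehat\alpha)$ is the prediction risk given the training data. $\mathbb E_{\boldsymbol\varepsilon}$ denotes expectation over the training noise $\boldsymbol\varepsilon$ only, with the training features and factors held fixed. **Theorem.** Suppose that $\Sigma_E=0$ and that $A$ and $\Sigma_Z$ both have rank $K$. 1. Almost surely on the event that $\mathbf Z$ has rank $K$, $X^\top\widehat\alpha=Z^\top\widehat\beta$ and $$R(\widehat\alpha)=\mathbb E_{(X,y)}[(X^\top\widehat\alpha-y)^2]=\mathbb E_{(Z,y)}[(Z^\top\widehat\beta-y)^2].$$ 2. Suppose in addition that $Z=\Sigma_Z^{1/2}\tilde Z$ and $\varepsilon=\sigma_\varepsilon\tilde\varepsilon$ almost surely, where $\tilde Z$ and $\tilde\varepsilon$ have mean zero and sub-Gaussian norm at most $L$. (Here $\|U\|_{\psi_2}=\inf\{t>0:\mathbb E\,e^{U^2/t^2}\le 2\}$ for real $U$, and $\|W\|_{\psi_2}=\sup_{\|v\|=1}\|v^\top W\|_{\psi_2}$ for a random vector $W$.) There are constants $C,c,c_1,c_2>0$, depending only on $L$, such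 that if $n>CK$, then with probability at least $1-c/n$ the matrix $\mathbf Z$ has rank $K$ and $$R(\widehat\alpha)-\sigma_\varepsilon^2\le c_1\,\sigma_\varepsilon^2\,\frac{K\log n}{n},\qquad \mathbb E_{\boldsymbol\varepsilon}[R(\widehat\alpha)]-\sigma_\varepsilon^2\ge c_2\,\sigma_\varepsilon^2\,\frac Kn ,$$ where the expectation $\mathbb E_{\boldsymbol\varepsilon}[R(\widehat\alpha)]$ is finite. -/

import Mathlib

open MeasureTheory ProbabilityTheory Matrix
open scoped ENNReal

noncomputable section

namespace FactorRegression

/-! ### The Moore-Penrose pseudo-inverse of a real matrix -/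

section Pinv

variable {m n : Type*} [Fintype m] [Fintype n]

/-- The four Penrose conditions: `P` is the Moore-Penrose pseudo-inverse of `B`. -/
structure IsPinv (B : Matrix m n ℝ) (P : Matrix n m ℝ) : Prop where
  mul_mul : B * P * B = B
  mul_mul' : P * B * P = P
  symm : (B * P).IsSymm
  symm' : (P * B).IsSymm

theorem IsPinv.unique {B : Matrix m n ℝ} {P Q : Matrix n m ℝ} (hP : IsPinv B P)
    (hQ : IsPinv B Q) : P = Q := by
  have e1 : B * P = B * Q := by
    have h1 : (B * Q) * (B * P) = B * P := by
      rw [← Matrix.mul_assoc, hQ.mul_mul]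
    have h2 : (B * P) * (B * Q) = B * Q := by
      rw [← Matrix.mul_assoc, hP.mul_mul]
    have h3 := congrArg Matrix.transpose h1
    rw [Matrix.transpose_mul, hP.symm.eq, hQ.symm.eq, h2] at h3
    exact h3.symm
  have e2 : P * B = Q * B := by
    have h1 : (P * B) * (Q * B) = P * B := by
      rw [Matrix.mul_assoc, ← Matrix.mul_assoc B, hQ.mul_mul]
    have h2 : (Q * B) * (P * B) = Q * B := by
      rw [Matrix.mul_assoc, ← Matrix.mul_assoc B, hP.mul_mul]
    have h3 := congrArg Matrix.transpose h1
    rw [Matrix.transpose_mul, hP.symm'.eq, hQ.symm'.eq, h2] at h3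
    exact h3.symm
  calc P = P * B * P := hP.mul_mul'.symm
    _ = Q * B * Q := by rw [e2, Matrix.mul_assoc, e1, ← Matrix.mul_assoc]
    _ = Q := hQ.mul_mul'

theorem exists_isPinv [DecidableEq n] (B : Matrix m n ℝ) : ∃ P, IsPinv B P := by
  have hG : (Bᵀ * B).IsHermitian := by
    simpa [Matrix.conjTranspose_eq_transpose_of_trivial] using
      Matrix.isHermitian_conjTranspose_mul_self B
  obtain ⟨U, d, hU, hU', hGd⟩ : ∃ (U : Matrix n n ℝ) (d : n → ℝ), U * Uᵀ = 1 ∧ Uᵀ * U = 1 ∧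
      Bᵀ * B = U * diagonal d * Uᵀ := by
    refine ⟨hG.eigenvectorUnitary, hG.eigenvalues, ?_, ?_, ?_⟩
    · simpa [star_eq_conjTranspose, Matrix.conjTranspose_eq_transpose_of_trivial] using
        Unitary.coe_mul_star_self hG.eigenvectorUnitary
    · simpa [star_eq_conjTranspose, Matrix.conjTranspose_eq_transpose_of_trivial] using
        Unitary.coe_star_mul_self hG.eigenvectorUnitary
    · have := hG.spectral_theorem
      simpa [Unitary.conjStarAlgAut_apply, star_eq_conjTranspose,
        Matrix.conjTranspose_eq_transpose_of_trivial, Function.comp_def] using this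
  set H : Matrix n n ℝ := U * diagonal (fun i => (d i)⁻¹) * Uᵀ with hH
  have cancel : ∀ a b : n → ℝ, (U * diagonal a * Uᵀ) * (U * diagonal b * Uᵀ)
      = U * diagonal (fun i => a i * b i) * Uᵀ := by
    intro a b
    calc (U * diagonal a * Uᵀ) * (U * diagonal b * Uᵀ)
        = U * diagonal a * (Uᵀ * U) * diagonal b * Uᵀ := by simp only [Matrix.mul_assoc]
      _ = _ := by rw [hU', Matrix.mul_one, Matrix.mul_assoc U, diagonal_mul_diagonal]
  have symm : ∀ a : n → ℝ, (U * diagonal a * Uᵀ)ᵀ = U * diagonal a * Uᵀ := by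
    intro a; simp [Matrix.transpose_mul, Matrix.mul_assoc]
  have GHG : (Bᵀ * B) * H * (Bᵀ * B) = Bᵀ * B := by
    rw [hGd, hH, cancel, cancel]; congr; ext i
    by_cases h : d i = 0 <;> simp [h]
  have HGH : H * (Bᵀ * B) * H = H := by
    rw [hGd, hH, cancel, cancel]; congr; ext i
    by_cases h : d i = 0 <;> simp [h]
  have key : B * H * (Bᵀ * B) = B := by
    rw [← sub_eq_zero, ← Matrix.conjTranspose_mul_self_eq_zero,
      Matrix.conjTranspose_eq_transpose_of_trivial]
    have : (B * H * (Bᵀ * B) - B) = B * (H * (Bᵀ * B) - 1) := by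
      rw [Matrix.mul_sub, Matrix.mul_one, Matrix.mul_assoc]
    have h0 : Bᵀ * (B * (H * (Bᵀ * B) - 1)) = 0 := by
      rw [← Matrix.mul_assoc, Matrix.mul_sub, ← Matrix.mul_assoc, GHG, Matrix.mul_one, sub_self]
    rw [this, Matrix.transpose_mul, Matrix.mul_assoc, h0, Matrix.mul_zero]
  refine ⟨H * Bᵀ, ?_, ?_, ?_, ?_⟩
  · rw [Matrix.mul_assoc, Matrix.mul_assoc, ← Matrix.mul_assoc, key]
  · calc H * Bᵀ * B * (H * Bᵀ) = (H * (Bᵀ * B) * H) * Bᵀ := by simp only [Matrix.mul_assoc]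
      _ = _ := by rw [HGH]
  · have hHs : Hᵀ = H := by rw [hH]; exact symm _
    simp [Matrix.IsSymm, Matrix.transpose_mul, hHs, Matrix.mul_assoc]
  · rw [Matrix.mul_assoc, hGd, hH, cancel]; exact symm _

/-- The Moore-Penrose pseudo-inverse `B⁺`. -/
def pinv [DecidableEq n] (B : Matrix m n ℝ) : Matrix n m ℝ := (exists_isPinv B).choose

theorem pinv_spec [DecidableEq n] (B : Matrix m n ℝ) : IsPinv B (pinv B) :=
  (exists_isPinv B).choose_spec

end Pinv

/-! ### The minimum-norm least-squares estimator -/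

section MinNorm

variable {m n : Type*} [Fintype m] [Fintype n]

/-- The Euclidean norm on `ℝ^ι`. -/
def l2norm {ι : Type*} [Fintype ι] (v : ι → ℝ) : ℝ := ‖WithLp.toLp 2 v‖

theorem l2norm_sq {ι : Type*} [Fintype ι] (v : ι → ℝ) : l2norm v ^ 2 = v ⬝ᵥ v := by
  rw [l2norm, EuclideanSpace.real_norm_sq_eq]
  simp [dotProduct, sq]

theorem dotProduct_self_nonneg {ι : Type*} [Fintype ι] (v : ι → ℝ) : 0 ≤ v ⬝ᵥ v :=
  l2norm_sq v ▸ sq_nonneg _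

theorem l2norm_le_iff {ι κ : Type*} [Fintype ι] [Fintype κ] (v : ι → ℝ) (w : κ → ℝ) :
    l2norm v ≤ l2norm w ↔ v ⬝ᵥ v ≤ w ⬝ᵥ w := by
  rw [← l2norm_sq, ← l2norm_sq]
  exact (pow_le_pow_iff_left₀ (norm_nonneg _) (norm_nonneg _) two_ne_zero).symm

/-- `α` minimises `‖X u - y‖` over all `u`. -/
def IsLeastSquares (X : Matrix m n ℝ) (y : m → ℝ) (α : n → ℝ) : Prop :=
  ∀ u : n → ℝ, l2norm (X *ᵥ α - y) ≤ l2norm (X *ᵥ u - y)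

/-- `α` has the smallest norm among all minimisers of `‖X u - y‖`. -/
def IsMinNormLS (X : Matrix m n ℝ) (y : m → ℝ) (α : n → ℝ) : Prop :=
  IsLeastSquares X y α ∧ ∀ u : n → ℝ, IsLeastSquares X y u → l2norm α ≤ l2norm u

theorem existsUnique_isMinNormLS [DecidableEq n] (X : Matrix m n ℝ) (y : m → ℝ) :
    ∃! α, IsMinNormLS X y α := by
  set P := pinv X with hPdef
  have hP : IsPinv X P := pinv_spec X
  set a := P *ᵥ y with ha
  have orth : ∀ w, (X *ᵥ w) ⬝ᵥ (X *ᵥ a - y) = 0 := by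
    intro w
    have h1 : X *ᵥ w = (X * P) *ᵥ (X *ᵥ w) := by
      rw [Matrix.mulVec_mulVec, hP.mul_mul]
    have h2 : (X * P) *ᵥ (X *ᵥ a - y) = 0 := by
      have h3 : X * P * X * P = X * P := by rw [hP.mul_mul]
      simp only [Matrix.mulVec_sub, ha, Matrix.mulVec_mulVec, ← Matrix.mul_assoc, h3, sub_self]
    calc (X *ᵥ w) ⬝ᵥ (X *ᵥ a - y) = ((X * P)ᵀ *ᵥ (X *ᵥ w)) ⬝ᵥ (X *ᵥ a - y) := by
          rw [hP.symm.eq, ← h1]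
      _ = 0 := by
          rw [Matrix.mulVec_transpose, ← Matrix.dotProduct_mulVec, h2, dotProduct_zero]
  have pyth : ∀ u, (X *ᵥ u - y) ⬝ᵥ (X *ᵥ u - y) =
      (X *ᵥ (u - a)) ⬝ᵥ (X *ᵥ (u - a)) + (X *ᵥ a - y) ⬝ᵥ (X *ᵥ a - y) := by
    intro u
    have : X *ᵥ u - y = X *ᵥ (u - a) + (X *ᵥ a - y) := by
      rw [Matrix.mulVec_sub]; abel
    rw [this, add_dotProduct, dotProduct_add, dotProduct_add, orth,
      dotProduct_comm (X *ᵥ a - y) (X *ᵥ (u - a)), orth]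
    ring
  have aLS : IsLeastSquares X y a := by
    intro u
    rw [l2norm_le_iff, pyth u]
    have := dotProduct_self_nonneg (X *ᵥ (u - a))
    linarith
  have ker : ∀ u, IsLeastSquares X y u → X *ᵥ (u - a) = 0 := by
    intro u hu
    have h := hu a
    rw [l2norm_le_iff, pyth u] at h
    have h0 := dotProduct_self_nonneg (X *ᵥ (u - a))
    exact dotProduct_self_eq_zero.1 (by linarith)
  have pyth2 : ∀ u, IsLeastSquares X y u →
      u ⬝ᵥ u = a ⬝ᵥ a + (u - a) ⬝ᵥ (u - a) := by
    intro u hu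
    have h1 : a = (P * X) *ᵥ a := by
      rw [ha, Matrix.mulVec_mulVec, hP.mul_mul']
    have h2 : a ⬝ᵥ (u - a) = 0 := by
      calc a ⬝ᵥ (u - a) = ((P * X)ᵀ *ᵥ a) ⬝ᵥ (u - a) := by rw [hP.symm'.eq, ← h1]
        _ = 0 := by
          rw [Matrix.mulVec_transpose, ← Matrix.dotProduct_mulVec, ← Matrix.mulVec_mulVec,
            ker u hu, Matrix.mulVec_zero, dotProduct_zero]
    have h3 : u = a + (u - a) := by abel
    conv_lhs => rw [h3]
    rw [add_dotProduct, dotProduct_add, dotProduct_add, h2, dotProduct_comm (u - a) a, h2]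
    ring
  refine ⟨a, ⟨aLS, fun u hu => ?_⟩, fun u hu => ?_⟩
  · rw [l2norm_le_iff, pyth2 u hu]
    have := dotProduct_self_nonneg (u - a)
    linarith
  · have h := hu.2 a aLS
    rw [l2norm_le_iff, pyth2 u hu.1] at h
    have h0 := dotProduct_self_nonneg (u - a)
    exact sub_eq_zero.1 (dotProduct_self_eq_zero.1 (by linarith))

/-- The minimum-norm least-squares estimator
`argmin {‖α‖ : ‖X α - y‖ = min_u ‖X u - y‖}`. -/
def minNormLS [DecidableEq n] (X : Matrix m n ℝ) (y : m → ℝ) : n → ℝ :=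
  (existsUnique_isMinNormLS X y).choose

theorem minNormLS_spec [DecidableEq n] (X : Matrix m n ℝ) (y : m → ℝ) :
    IsMinNormLS X y (minNormLS X y) :=
  (existsUnique_isMinNormLS X y).choose_spec.1

end MinNorm

/-! ### Covariances and sub-Gaussian norms -/

section Prob

variable {Ω : Type*} [MeasurableSpace Ω]

/-- The covariance matrix of a random vector (with square-integrable entries). -/
def covMatrix {ι : Type*} (P : Measure Ω) (W : Ω → ι → ℝ) : Matrix ι ι ℝ :=
  Matrix.of fun i j => cov[fun ω => W ω i, fun ω => W ω j; P]

/-- The sub-Gaussian norm `inf {t > 0 : 𝔼 exp (U² / t²) ≤ 2}` of a real random variable,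
with value `∞` if there is no such `t`. -/
def psi2Norm (P : Measure Ω) (U : Ω → ℝ) : ℝ≥0∞ :=
  ⨅ (t : ℝ) (_ : 0 < t) (_ : ∫⁻ ω, ENNReal.ofReal (Real.exp (U ω ^ 2 / t ^ 2)) ∂P ≤ 2),
    ENNReal.ofReal t

/-- The sub-Gaussian norm of a random vector: the supremum of the sub-Gaussian norms of its
one-dimensional projections onto unit vectors. -/
def psi2NormVec {ι : Type*} [Fintype ι] (P : Measure Ω) (W : Ω → ι → ℝ) : ℝ≥0∞ :=
  ⨆ (v : ι → ℝ) (_ : l2norm v = 1), psi2Norm P (fun ω => v ⬝ᵥ W ω)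

end Prob

/-! ### The factor regression model -/

/-- The factor regression model `X = A Z + E`, `y = Zᵀ β + ε` with `K` factors and `p` features,
observed on a training sample of size `n`. The index `some i` stands for the `i`-th training
observation and `none` for the new observation at which the response is to be predicted. -/
structure Model {Ω : Type*} [MeasurableSpace Ω] (P : Measure Ω) (n p K : ℕ) where
  /-- the loading matrix -/
  A : Matrix (Fin p) (Fin K) ℝ
  /-- the latent regression vector -/
  β : Fin K → ℝ
  /-- the latent factors -/
  Z : Option (Fin n) → Ω → Fin K → ℝ
  /-- the feature noise -/
  E : Option (Fin n) → Ω → Fin p → ℝ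
  /-- the response noise -/
  ε : Option (Fin n) → Ω → ℝ
  measurable_Z : ∀ i, Measurable (Z i)
  measurable_E : ∀ i, Measurable (E i)
  measurable_ε : ∀ i, Measurable (ε i)
  /-- second moments are finite, so that `Σ_Z`, `Σ_E` and `σ_ε²` make sense -/
  memLp_Z : MemLp (Z none) 2 P
  memLp_E : MemLp (E none) 2 P
  memLp_ε : MemLp (ε none) 2 P
  mean_Z : ∀ k, ∫ ω, Z none ω k ∂P = 0
  mean_E : ∀ j, ∫ ω, E none ω j ∂P = 0
  mean_ε : ∫ ω, ε none ω ∂P = 0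
  /-- `Z`, `E` and `ε` are independent -/
  indep_E_ε : IndepFun (E none) (ε none) P
  indep_Z : IndepFun (Z none) (fun ω => (E none ω, ε none ω)) P
  /-- the observations are independent ... -/
  iIndep : iIndepFun (fun i ω => (Z i ω, E i ω, ε i ω)) P
  /-- ... and identically distributed -/
  identDistrib : ∀ i, IdentDistrib (fun ω => (Z i ω, E i ω, ε i ω))
    (fun ω => (Z none ω, E none ω, ε none ω)) P P

namespace Model

variable {Ω : Type*} [MeasurableSpace Ω] {P : Measure Ω} {n p K : ℕ} (M : Model P n p K)

/-- The features `X = A Z + E` of an observation. -/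
def X (i : Option (Fin n)) (ω : Ω) : Fin p → ℝ := M.A *ᵥ M.Z i ω + M.E i ω

/-- The response `y = Zᵀ β + ε` of an observation. -/
def y (i : Option (Fin n)) (ω : Ω) : ℝ := M.Z i ω ⬝ᵥ M.β + M.ε i ω

/-- The covariance matrix `Σ_Z` of the factors. -/
def covZ : Matrix (Fin K) (Fin K) ℝ := covMatrix P (M.Z none)

/-- The covariance matrix `Σ_E` of the feature noise. -/
def covE : Matrix (Fin p) (Fin p) ℝ := covMatrix P (M.E none)

/-- The variance `σ_ε²` of the response noise. -/
def noiseVar : ℝ := Var[M.ε none; P]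

/-- The `n × p` data matrix with rows `X₁, …, X_n`. -/
def dataX (ω : Ω) : Matrix (Fin n) (Fin p) ℝ := Matrix.of fun i => M.X (some i) ω

/-- The `n × K` factor matrix with rows `Z₁, …, Z_n`. -/
def dataZ (ω : Ω) : Matrix (Fin n) (Fin K) ℝ := Matrix.of fun i => M.Z (some i) ω

/-- The response vector `(y₁, …, y_n)`. -/
def dataY (ω : Ω) : Fin n → ℝ := fun i => M.y (some i) ω

/-- The noise vector `(ε₁, …, ε_n)`. -/
def dataε (ω : Ω) : Fin n → ℝ := fun i => M.ε (some i) ω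

/-- The minimum-norm estimator computed from the training data `(X₁, y₁), …, (X_n, y_n)`. -/
def αHat (ω : Ω) : Fin p → ℝ := minNormLS (M.dataX ω) (M.dataY ω)

/-- The oracle least-squares coefficients, the pseudo-inverse of the factor matrix applied to
the response vector. -/
def βHat (ω : Ω) : Fin K → ℝ := pinv (M.dataZ ω) *ᵥ M.dataY ω

/-- The prediction risk `R(α) = 𝔼_{(X,y)} (Xᵀ α - y)²` at a new observation. -/
def risk (α : Fin p → ℝ) : ℝ := ∫ ω, (M.X none ω ⬝ᵥ α - M.y none ω) ^ 2 ∂P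

/-- The risk of the minimum-norm estimator as a function of the outcome `ω`, which determines
the training features and factors, and of an outcome `ω'`, which determines the training noise
`ε₁, …, ε_n`. On the diagonal this is the risk of `αHat`. -/
def riskResampled (ω ω' : Ω) : ℝ :=
  M.risk (minNormLS (M.dataX ω) (M.dataZ ω *ᵥ M.β + M.dataε ω'))

theorem riskResampled_self (ω : Ω) : M.riskResampled ω ω = M.risk (M.αHat ω) := rfl

/-- The expected risk `𝔼_ε R(αHat)`: only the training noise `ε₁, …, ε_n` is averaged, while the
training features and factors stay fixed. -/
def noiseMeanRisk (ω : Ω) : ℝ := ∫ ω', M.riskResampled ω ω' ∂P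

/-- `A` and `Σ_Z` both have full rank `K`. -/
def FullRank : Prop := M.A.rank = K ∧ M.covZ.rank = K

/-- `Z = Σ_Z^{1/2} Z̃` and `ε = σ_ε ε̃`, where `Z̃` and `ε̃` have mean zero and sub-Gaussian
norm at most `L`. Here `S` is the positive semidefinite square root of `Σ_Z`. -/
def IsSubGaussian (L : ℝ) : Prop :=
  (∃ (S : Matrix (Fin K) (Fin K) ℝ) (Zt : Ω → Fin K → ℝ),
    S.PosSemidef ∧ S * S = M.covZ ∧ Measurable Zt ∧
    (∀ᵐ ω ∂P, M.Z none ω = S *ᵥ Zt ω) ∧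
    (∀ k, ∫ ω, Zt ω k ∂P = 0) ∧ psi2NormVec P Zt ≤ ENNReal.ofReal L) ∧
  ∃ εt : Ω → ℝ, Measurable εt ∧
    (∀ᵐ ω ∂P, M.ε none ω = √M.noiseVar * εt ω) ∧
    ∫ ω, εt ω ∂P = 0 ∧ psi2Norm P εt ≤ ENNReal.ofReal L

end Model

end FactorRegression

end

/-! Since `Σ_E = 0`, all feature noises vanish almost surely and the data matrix is `𝐗 = 𝐙 Aᵀ`. The
normal equations for `𝐗` are `A` applied to those for `𝐙`, and `A` is injective, so `Aᵀ α̂` solves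
the normal equations of `𝐙`. When `𝐙` has rank `K` their only solution is `𝐙⁺ 𝐲`
(`transpose_mulVec_αHat`). This gives part 1; it uses that `α̂` is a least-squares solution, not
that its norm is minimal.

For part 2, let `S` be the square root of `Σ_Z` and `V = 𝐙 S⁻¹`. The excess risk is the quadratic
form of `Σ_Z` at `Aᵀ α̂ - β`, which equals `‖V⁺ 𝛆‖²` with `V⁺ = (Vᵀ V)⁻¹ Vᵀ` (`risk_minNormLS`). The
rows of `V` are independent, isotropic and sub-Gaussian. Chernoff bounds on a net of the sphere give
`n / 16 ≤ Vᵀ V ≤ 8 T² n` with probability `1 - O(1 / n)` once `n > C K`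
(`exists_random_matrix_bounds`).

On that event each row of `V⁺` has squared norm at most `16 / n`, and these squared norms add up to
at least `K / (8 T² n)` (`leftInv_row_le`, `le_sum_leftInv`). The noise is independent of `V`, so
each coordinate of `V⁺ 𝛆` has a sub-Gaussian tail given `V`; a union bound over `K ≤ n` coordinates
yields the upper bound with its factor `log n`. Averaging `‖V⁺ 𝛆‖²` over the noise gives exactly
`σ_ε²` times the sum of the squared row norms, whence the lower bound. -/

namespace FactorRegression

/-! ### Nets of the unit sphere -/

section Net

variable {F : Type*} [NormedAddCommGroup F] [NormedSpace ℝ F]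

-- Volume comparison: the balls of radius `δ / 2` around the points are disjoint and lie in the ball
-- of radius `1 + δ / 2 ≤ 3 / 2`.
open Module Metric in
theorem card_le_of_separated_of_norm_le_one [FiniteDimensional ℝ F] {δ : ℝ}
    (hδ : 0 < δ) (hδ' : δ ≤ 1) (s : Finset F) (hs : ∀ c ∈ s, ‖c‖ ≤ 1) (h : ∀ c ∈ s, ∀ d ∈ s, c ≠ d → δ ≤ ‖c - d‖) :
    (s.card : ℝ) ≤ (3 / δ) ^ finrank ℝ F := by
  borelize F
  let μ : Measure F := Measure.addHaar
  have hδ2 : 0 < δ / 2 := by positivity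
  have hρ : (0 : ℝ) < 3 / 2 := by norm_num
  have D : Set.Pairwise (s : Set F) (Function.onFun Disjoint fun c => ball (c : F) (δ / 2)) := by
    rintro c hc d hd hcd
    apply ball_disjoint_ball
    rw [dist_eq_norm]
    linarith [h c hc d hd hcd]
  have hsub : (⋃ c ∈ s, ball (c : F) (δ / 2)) ⊆ ball (0 : F) (3 / 2) := by
    refine Set.iUnion₂_subset fun x hx => ball_subset_ball' ?_
    rw [dist_zero_right]
    linarith [hs x hx]
  have I : (s.card : ℝ≥0∞) * ENNReal.ofReal ((δ / 2) ^ finrank ℝ F) * μ (ball 0 1) ≤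
      ENNReal.ofReal ((3 / 2 : ℝ) ^ finrank ℝ F) * μ (ball 0 1) :=
    calc (s.card : ℝ≥0∞) * ENNReal.ofReal ((δ / 2) ^ finrank ℝ F) * μ (ball 0 1)
        = μ (⋃ c ∈ s, ball (c : F) (δ / 2)) := by
          rw [measure_biUnion_finset D fun c _ => measurableSet_ball]
          simp only [μ.addHaar_ball_of_pos _ hδ2, Finset.sum_const, nsmul_eq_mul, mul_assoc]
      _ ≤ μ (ball (0 : F) (3 / 2)) := measure_mono hsub
      _ = _ := by simp only [μ.addHaar_ball_of_pos _ hρ]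
  have J := (ENNReal.mul_le_mul_iff_left (measure_ball_pos μ _ zero_lt_one).ne'
    measure_ball_lt_top.ne).1 I
  have H := ENNReal.toReal_le_of_le_ofReal (pow_nonneg hρ.le _) J
  rw [ENNReal.toReal_mul, ENNReal.toReal_natCast, ENNReal.toReal_ofReal (by positivity),
    ← le_div_iff₀ (by positivity), ← div_pow,
    div_div_div_cancel_right₀ two_ne_zero] at H
  exact H

/-- The unit sphere has a `δ`-net with at most `(3 / δ) ^ dim` points. -/
theorem exists_sphere_net [FiniteDimensional ℝ F] {δ : ℝ} (hδ : 0 < δ) (hδ' : δ ≤ 1) :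
    ∃ s : Finset F, (s.card : ℝ) ≤ (3 / δ) ^ Module.finrank ℝ F ∧ (∀ u ∈ s, ‖u‖ = 1) ∧
      ∀ v : F, ‖v‖ = 1 → ∃ u ∈ s, ‖v - u‖ ≤ δ := by
  classical
  let Q : ℕ → Prop := fun k => ∃ s : Finset F, s.card = k ∧ (∀ u ∈ s, ‖u‖ = 1) ∧
    ∀ c ∈ s, ∀ d ∈ s, c ≠ d → δ ≤ ‖c - d‖
  have hb : ∀ k, Q k → (k : ℝ) ≤ (3 / δ) ^ Module.finrank ℝ F := by
    rintro k ⟨s, rfl, h1, h2⟩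
    exact card_le_of_separated_of_norm_le_one hδ hδ' s (fun c hc => (h1 c hc).le) h2
  let b := ⌈(3 / δ) ^ Module.finrank ℝ F⌉₊
  have hle : ∀ k, Q k → k ≤ b := fun k hk => by
    exact_mod_cast (hb k hk).trans (Nat.le_ceil _)
  -- A separated set of maximal cardinality is a net. The maximum exists because cardinalities are
  -- bounded by `b`, and the empty set starts the search.
  have hQ : Q (Nat.findGreatest Q b) :=
    Nat.findGreatest_spec (m := 0) (Nat.zero_le _) ⟨∅, by simp⟩
  have hcard := hb _ hQ
  obtain ⟨s, hs, h1, h2⟩ := hQ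
  refine ⟨s, by rw [hs]; exact hcard, h1, fun v hv => ?_⟩
  by_contra! hv'
  have hvs : v ∉ s := fun hmem => by
    have := hv' v hmem
    simp at this; linarith
  have hQ' : Q (s.card + 1) := by
    refine ⟨insert v s, Finset.card_insert_of_notMem hvs, ?_, ?_⟩
    · simpa [hv] using h1
    · intro c hc d hd hcd
      rcases Finset.mem_insert.1 hc with hc | hc <;> rcases Finset.mem_insert.1 hd with hd | hd
      · exact absurd (hc.trans hd.symm) hcd
      · rw [hc]; exact (hv' d hd).le
      · rw [hd, norm_sub_rev]; exact (hv' c hc).le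
      · exact h2 c hc d hd hcd
  have := Nat.le_findGreatest (hle _ hQ') hQ'
  omega

/-- Replacing a unit vector by its nearest net point costs at most `‖T‖ / 2`, which is absorbed on
the left-hand side. -/
theorem norm_le_two_mul_of_net {G : Type*} [NormedAddCommGroup G] [NormedSpace ℝ G]
    (T : F →L[ℝ] G) {δ m : ℝ} (hδ : δ ≤ 1 / 2) (hm : 0 ≤ m) (s : Finset F)
    (hs : ∀ v : F, ‖v‖ = 1 → ∃ u ∈ s, ‖v - u‖ ≤ δ) (h : ∀ u ∈ s, ‖T u‖ ≤ m) :
    ‖T‖ ≤ 2 * m := by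
  have key : ‖T‖ ≤ m + ‖T‖ / 2 := by
    refine ContinuousLinearMap.opNorm_le_of_unit_norm (by positivity) fun v hv => ?_
    obtain ⟨u, hu, hvu⟩ := hs v hv
    calc ‖T v‖ = ‖T u + T (v - u)‖ := by rw [← map_add]; congr 2; abel
      _ ≤ ‖T u‖ + ‖T (v - u)‖ := norm_add_le _ _
      _ ≤ m + ‖T‖ * (1 / 2) := by
        gcongr
        · exact h u hu
        · exact (T.le_opNorm _).trans (by gcongr; exact hvu.trans hδ)
      _ = m + ‖T‖ / 2 := by ring
  linarith

/-- Passing from the net to the sphere loses `‖T‖ δ`, so the lower bound needs an upper bound on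
`‖T‖` beforehand. -/
theorem le_norm_apply_of_net {G : Type*} [NormedAddCommGroup G] [NormedSpace ℝ G]
    (T : F →L[ℝ] G) {δ b m : ℝ} (hT : ‖T‖ ≤ b) (s : Finset F)
    (hs : ∀ v : F, ‖v‖ = 1 → ∃ u ∈ s, ‖v - u‖ ≤ δ) (h : ∀ u ∈ s, m ≤ ‖T u‖) (v : F) :
    (m - b * δ) * ‖v‖ ≤ ‖T v‖ := by
  by_cases hv : v = 0
  · simp [hv]
  have hv' : 0 < ‖v‖ := norm_pos_iff.2 hv
  have unit : ∀ w : F, ‖w‖ = 1 → m - b * δ ≤ ‖T w‖ := by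
    intro w hw
    obtain ⟨u, hu, hwu⟩ := hs w hw
    have h1 : ‖T u‖ ≤ ‖T w‖ + ‖T (w - u)‖ := by
      have : T u = T w - T (w - u) := by rw [← map_sub]; congr 1; abel
      rw [this]; exact norm_sub_le _ _
    have h2 : ‖T (w - u)‖ ≤ b * δ := (T.le_opNorm _).trans (by
      gcongr; exact (norm_nonneg _).trans hT)
    linarith [h u hu]
  have := unit (‖v‖⁻¹ • v) (by rw [norm_smul, norm_inv, norm_norm, inv_mul_cancel₀ hv'.ne'])
  rw [map_smul, norm_smul, norm_inv, norm_norm, inv_mul_eq_div, le_div_iff₀ hv'] at this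
  exact this

end Net

/-! ### Least squares with a full-rank design -/

section LeastSquares

variable {m n : Type*} [Fintype m] [Fintype n]

theorem mulVec_eq_zero_of_bound {B : Matrix m n ℝ} {a : ℝ} (ha : 0 < a)
    (h : ∀ v, a * (v ⬝ᵥ v) ≤ (B *ᵥ v) ⬝ᵥ (B *ᵥ v)) {v : n → ℝ} (hv : B *ᵥ v = 0) : v = 0 := by
  have h1 := h v
  rw [hv, dotProduct_zero] at h1
  have h2 := dotProduct_self_nonneg v
  exact dotProduct_self_eq_zero.1 (le_antisymm (by nlinarith) h2)

theorem dotProduct_transpose_mul_mulVec (B : Matrix m n ℝ) (u v : n → ℝ) :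
    u ⬝ᵥ ((Bᵀ * B) *ᵥ v) = (B *ᵥ u) ⬝ᵥ (B *ᵥ v) := by
  rw [← Matrix.mulVec_mulVec, Matrix.dotProduct_mulVec, Matrix.vecMul_transpose]

/-- The normal equations. -/
theorem IsLeastSquares.transpose_mulVec_eq_zero {X : Matrix m n ℝ} {y : m → ℝ} {α : n → ℝ}
    (h : IsLeastSquares X y α) : Xᵀ *ᵥ (X *ᵥ α - y) = 0 := by
  set r := X *ᵥ α - y with hr
  set g := Xᵀ *ᵥ r with hg
  have hgg : (X *ᵥ g) ⬝ᵥ r = g ⬝ᵥ g := by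
    conv_rhs => rw [hg, Matrix.dotProduct_mulVec, Matrix.vecMul_transpose]
  -- Compare `α` with a step of length `t` along the negative gradient.
  have key : ∀ t : ℝ, 0 ≤ t ^ 2 * ((X *ᵥ g) ⬝ᵥ (X *ᵥ g)) - 2 * t * (g ⬝ᵥ g) := by
    intro t
    have h1 := (l2norm_le_iff _ _).1 (h (α - t • g))
    have h2 : X *ᵥ (α - t • g) - y = r - t • (X *ᵥ g) := by
      rw [Matrix.mulVec_sub, Matrix.mulVec_smul, hr]; abel
    rw [h2] at h1
    simp only [sub_dotProduct, dotProduct_sub, smul_dotProduct, dotProduct_smul, smul_eq_mul,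
      dotProduct_comm r (X *ᵥ g), hgg, ← hr] at h1
    linarith
  set q := (X *ᵥ g) ⬝ᵥ (X *ᵥ g)
  have hq : 0 ≤ q := dotProduct_self_nonneg _
  have hg0 := dotProduct_self_nonneg g
  refine dotProduct_self_eq_zero.1 (le_antisymm ?_ hg0)
  by_contra! hpos
  -- The optimal step is `g ⬝ᵥ g / q`; the `+ 1` covers `q = 0`.
  have h3 := key (g ⬝ᵥ g / (q + 1))
  have h4 : (g ⬝ᵥ g / (q + 1)) ^ 2 * q - 2 * (g ⬝ᵥ g / (q + 1)) * (g ⬝ᵥ g)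
      = -((g ⬝ᵥ g) ^ 2 * (q + 2)) / (q + 1) ^ 2 := by field_simp; ring
  rw [h4] at h3
  have : 0 < (g ⬝ᵥ g) ^ 2 * (q + 2) / (q + 1) ^ 2 := by positivity
  rw [neg_div] at h3
  linarith

/-- The pseudo-inverse solves the normal equations. -/
theorem transpose_mulVec_pinv_sub_eq_zero [DecidableEq n] (X : Matrix m n ℝ) (y : m → ℝ) :
    Xᵀ *ᵥ (X *ᵥ (pinv X *ᵥ y) - y) = 0 := by
  have hP := pinv_spec X
  have : Xᵀ * (X * pinv X) = Xᵀ := by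
    have := congrArg Matrix.transpose hP.mul_mul
    rwa [Matrix.transpose_mul, hP.symm.eq] at this
  rw [Matrix.mulVec_sub, Matrix.mulVec_mulVec, Matrix.mulVec_mulVec,
    Matrix.mul_assoc, this, sub_self]

variable [DecidableEq n]

/-- The left inverse `(Bᵀ B)⁻¹ Bᵀ` of a matrix `B` with independent columns. -/
noncomputable def leftInv (B : Matrix m n ℝ) : Matrix n m ℝ := (Bᵀ * B)⁻¹ * Bᵀ

variable {B : Matrix m n ℝ} {a b : ℝ}

theorem isUnit_det_transpose_mul_self (hB : ∀ v, B *ᵥ v = 0 → v = 0) :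
    IsUnit (Bᵀ * B).det := by
  rw [← Matrix.isUnit_iff_isUnit_det, ← Matrix.mulVec_injective_iff_isUnit]
  refine (injective_iff_map_eq_zero (Matrix.mulVecLin (Bᵀ * B))).2 fun v hv => hB v ?_
  have h1 := dotProduct_transpose_mul_mulVec B v v
  rw [Matrix.mulVecLin_apply] at hv
  rw [hv, dotProduct_zero] at h1
  exact dotProduct_self_eq_zero.1 h1.symm

/-- Uniqueness in the normal equations. Different estimators are identified by showing that they
solve the same ones. -/
theorem eq_leftInv_mulVec (hB : ∀ v, B *ᵥ v = 0 → v = 0) {v : n → ℝ} {e : m → ℝ}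
    (h : Bᵀ *ᵥ (B *ᵥ v - e) = 0) : v = leftInv B *ᵥ e := by
  rw [Matrix.mulVec_sub, Matrix.mulVec_mulVec, sub_eq_zero] at h
  rw [leftInv, ← Matrix.mulVec_mulVec, ← h, Matrix.mulVec_mulVec,
    Matrix.nonsing_inv_mul _ (isUnit_det_transpose_mul_self hB), Matrix.one_mulVec]

theorem leftInv_mul (hB : ∀ v, B *ᵥ v = 0 → v = 0) : leftInv B * B = 1 := by
  rw [leftInv, Matrix.mul_assoc, Matrix.nonsing_inv_mul _ (isUnit_det_transpose_mul_self hB)]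

/-- Row `k` is `B g` with `g = (Bᵀ B)⁻¹ e_k`, and `‖B g‖² = g k`. Hence `a (g k)² ≤ a ‖g‖² ≤ g k`,
so `g k ≤ 1 / a`. -/
theorem leftInv_row_le (ha : 0 < a) (h : ∀ v, a * (v ⬝ᵥ v) ≤ (B *ᵥ v) ⬝ᵥ (B *ᵥ v)) (k : n) :
    leftInv B k ⬝ᵥ leftInv B k ≤ 1 / a := by
  have hB : ∀ v, B *ᵥ v = 0 → v = 0 := fun v => mulVec_eq_zero_of_bound ha h
  set g : n → ℝ := (Bᵀ * B)⁻¹ *ᵥ Pi.single k 1 with hg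
  have hsymm : ((Bᵀ * B)⁻¹)ᵀ = (Bᵀ * B)⁻¹ := by
    rw [Matrix.transpose_nonsing_inv, Matrix.transpose_mul, Matrix.transpose_transpose]
  have hrow : leftInv B k = B *ᵥ g := by
    have h1 : leftInv B k = Pi.single k 1 ᵥ* leftInv B := by
      ext i; simp
    rw [h1, leftInv, ← Matrix.vecMul_vecMul, Matrix.vecMul_transpose, hg,
      ← Matrix.vecMul_transpose (Bᵀ * B)⁻¹, hsymm]
  have hk : (B *ᵥ g) ⬝ᵥ (B *ᵥ g) = g k := by
    rw [← dotProduct_transpose_mul_mulVec, hg, Matrix.mulVec_mulVec,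
      Matrix.mul_nonsing_inv _ (isUnit_det_transpose_mul_self hB), Matrix.one_mulVec, ← hg]
    simp
  have h1 := h g
  have h2 : g k ^ 2 ≤ g ⬝ᵥ g := by
    rw [sq]
    exact Finset.single_le_sum (f := fun i => g i * g i) (fun i _ => mul_self_nonneg _)
      (Finset.mem_univ k)
  have h3 : 0 ≤ g k := hk ▸ dotProduct_self_nonneg _
  rw [hrow, hk, le_div_iff₀ ha]
  rw [hk] at h1
  by_contra! h4
  have h5 : 0 < g k := by
    rcases h3.eq_or_lt with h0 | h0
    · rw [← h0] at h4; simp at h4; linarith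
    · exact h0
  nlinarith

/-- Row `k` of the left inverse pairs to `1` with column `k` of `B`, whose squared norm is at most
`b`. Cauchy–Schwarz bounds each squared row norm below by `1 / b`. -/
theorem le_sum_leftInv (ha : 0 < a) (hb : 0 < b)
    (h : ∀ v, a * (v ⬝ᵥ v) ≤ (B *ᵥ v) ⬝ᵥ (B *ᵥ v))
    (h' : ∀ v, (B *ᵥ v) ⬝ᵥ (B *ᵥ v) ≤ b * (v ⬝ᵥ v)) :
    (Fintype.card n : ℝ) / b ≤ ∑ k, leftInv B k ⬝ᵥ leftInv B k := by
  have hB := leftInv_mul fun v => mulVec_eq_zero_of_bound ha h (v := v)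
  have h1 : ∀ k, 1 / b ≤ leftInv B k ⬝ᵥ leftInv B k := by
    intro k
    have h2 : leftInv B k ⬝ᵥ (B *ᵥ Pi.single k 1) = 1 := by
      have := congrFun (congrFun hB k) k
      rw [Matrix.mul_apply, Matrix.one_apply_eq] at this
      simpa [dotProduct] using this
    have h3 := h' (Pi.single k 1)
    simp only [dotProduct_single, Pi.single_eq_same, mul_one] at h3
    have h4 := Finset.sum_mul_sq_le_sq_mul_sq Finset.univ (leftInv B k) (B *ᵥ Pi.single k 1)
    change (leftInv B k ⬝ᵥ (B *ᵥ Pi.single k 1)) ^ 2 ≤ _ at h4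
    rw [h2] at h4
    simp only [sq, ← dotProduct.eq_1] at h4
    rw [div_le_iff₀ hb]
    calc 1 = 1 * 1 := by ring
      _ ≤ _ := h4
      _ ≤ _ := by
        gcongr
        exact dotProduct_self_nonneg _
  calc (Fintype.card n : ℝ) / b = ∑ _k : n, 1 / b := by simp [div_eq_mul_inv]
    _ ≤ _ := Finset.sum_le_sum fun k _ => h1 k

end LeastSquares

/-- Two-sided control of a matrix by its values on a net of the unit sphere. -/
theorem bounds_of_net {m n : Type*} [Fintype m] [Fintype n] [DecidableEq n]
    (B : Matrix m n ℝ) {δ lo hi : ℝ}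
    (hδ : δ ≤ 1 / 2) (hhi : 0 ≤ hi) (hlo : 2 * hi * δ ≤ lo)
    (s : Finset (EuclideanSpace ℝ n))
    (hs : ∀ v : EuclideanSpace ℝ n, ‖v‖ = 1 → ∃ u ∈ s, ‖v - u‖ ≤ δ)
    (h : ∀ u ∈ s, l2norm (B *ᵥ u.ofLp) ≤ hi) (h' : ∀ u ∈ s, lo ≤ l2norm (B *ᵥ u.ofLp))
    (v : n → ℝ) :
    (lo - 2 * hi * δ) ^ 2 * (v ⬝ᵥ v) ≤ (B *ᵥ v) ⬝ᵥ (B *ᵥ v) ∧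
      (B *ᵥ v) ⬝ᵥ (B *ᵥ v) ≤ (2 * hi) ^ 2 * (v ⬝ᵥ v) := by
  let T : EuclideanSpace ℝ n →L[ℝ] EuclideanSpace ℝ m :=
    (Matrix.toEuclideanLin B).toContinuousLinearMap
  have hT : ∀ u : EuclideanSpace ℝ n, ‖T u‖ = l2norm (B *ᵥ u.ofLp) := fun u => rfl
  have hn : ‖T‖ ≤ 2 * hi :=
    norm_le_two_mul_of_net T hδ hhi s hs fun u hu => by rw [hT]; exact h u hu
  have h1 := le_norm_apply_of_net T hn s hs (fun u hu => by rw [hT]; exact h' u hu)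
    (WithLp.toLp 2 v)
  have h2 := T.le_of_opNorm_le hn (WithLp.toLp 2 v)
  rw [hT] at h1 h2
  change _ * l2norm v ≤ l2norm (B *ᵥ v) at h1
  change l2norm (B *ᵥ v) ≤ _ * l2norm v at h2
  have h0 : 0 ≤ l2norm v := norm_nonneg _
  have h0' : 0 ≤ l2norm (B *ᵥ v) := norm_nonneg _
  rw [← l2norm_sq, ← l2norm_sq, ← mul_pow, ← mul_pow]
  exact ⟨pow_le_pow_left₀ (mul_nonneg (by linarith) h0) h1 2, pow_le_pow_left₀ h0' h2 2⟩

/-! ### Tail bounds for sub-Gaussian random variables -/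

section Tail

variable {Ω : Type*} [MeasurableSpace Ω] {P : Measure Ω}

/-- The strict `L < T` avoids asking whether the infimum is attained: some admissible `t < T`
exists, and the exponential moment decreases in the scale. -/
theorem lintegral_exp_le_of_psi2Norm_le {U : Ω → ℝ} {L T : ℝ} (hLT : L < T) (hT : 0 < T)
    (h : psi2Norm P U ≤ ENNReal.ofReal L) :
    ∫⁻ ω, ENNReal.ofReal (Real.exp (U ω ^ 2 / T ^ 2)) ∂P ≤ 2 := by
  have h1 : psi2Norm P U < ENNReal.ofReal T :=
    h.trans_lt ((ENNReal.ofReal_lt_ofReal_iff hT).2 hLT)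
  simp only [psi2Norm, iInf_lt_iff] at h1
  obtain ⟨t, ht, h2, htT⟩ := h1
  have htT' : t < T := (ENNReal.ofReal_lt_ofReal_iff hT).1 htT
  refine (lintegral_mono fun ω => ?_).trans h2
  gcongr

theorem integrable_and_integral_le_of_lintegral_le {f : Ω → ℝ} (hf : Measurable f)
    (h0 : ∀ ω, 0 ≤ f ω) {c : ℝ} (hc : 0 ≤ c)
    (h : ∫⁻ ω, ENNReal.ofReal (f ω) ∂P ≤ ENNReal.ofReal c) :
    Integrable f P ∧ ∫ ω, f ω ∂P ≤ c := by
  constructor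
  · refine ⟨hf.aestronglyMeasurable, ?_⟩
    rw [hasFiniteIntegral_iff_ofReal (Filter.Eventually.of_forall h0)]
    exact h.trans_lt ENNReal.ofReal_lt_top
  · rw [integral_eq_lintegral_of_nonneg_ae (Filter.Eventually.of_forall h0)
      hf.aestronglyMeasurable]
    exact ENNReal.toReal_le_of_le_ofReal hc h

/-- `U` has an exponential square moment at scale `T`. -/
structure ExpSq (P : Measure Ω) (U : Ω → ℝ) (T : ℝ) : Prop where
  integrable : Integrable (fun ω => Real.exp (U ω ^ 2 / T ^ 2)) P
  integral_le : ∫ ω, Real.exp (U ω ^ 2 / T ^ 2) ∂P ≤ 2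

theorem expSq_of_psi2Norm_le {U : Ω → ℝ} (hU : Measurable U) {L T : ℝ} (hLT : L < T)
    (hT : 0 < T) (h : psi2Norm P U ≤ ENNReal.ofReal L) : ExpSq P U T := by
  have h1 := lintegral_exp_le_of_psi2Norm_le hLT hT h
  obtain ⟨h2, h3⟩ := integrable_and_integral_le_of_lintegral_le
    (f := fun ω => Real.exp (U ω ^ 2 / T ^ 2)) (P := P) (by fun_prop)
    (fun ω => (Real.exp_pos _).le) (c := 2) (by norm_num) (by simpa using h1)
  exact ⟨h2, h3⟩

theorem ExpSq.congr_identDistrib {Ω' : Type*} [MeasurableSpace Ω'] {P' : Measure Ω'}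
    {U : Ω → ℝ} {U' : Ω' → ℝ} {T : ℝ} (h : ExpSq P U T) (hUU' : IdentDistrib U U' P P') :
    ExpSq P' U' T := by
  have h1 := hUU'.comp (u := fun x => Real.exp (x ^ 2 / T ^ 2)) (by fun_prop)
  refine ⟨h1.integrable_iff.1 h.integrable, ?_⟩
  have := h1.integral_eq
  simp only [Function.comp_def] at this
  rw [← this]
  exact h.integral_le

/-- Invert `1 + x + x² / 2 ≤ exp x`, using `(1 + x + x² / 2)(1 - x + x² / 2) = 1 + x⁴ / 4`. -/
theorem exp_neg_le {x : ℝ} (hx : 0 ≤ x) : Real.exp (-x) ≤ 1 - x + x ^ 2 / 2 := by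
  have h1 := Real.quadratic_le_exp_of_nonneg hx
  rw [Real.exp_neg, inv_le_comm₀ (Real.exp_pos _) (by nlinarith [sq_nonneg (x - 1)])]
  refine le_trans ?_ h1
  rw [inv_le_iff_one_le_mul₀ (by nlinarith [sq_nonneg (x - 1)])]
  nlinarith [sq_nonneg (x ^ 2)]

/-- Isolates a linear term, which disappears in expectation for a centred variable, from one
controlled by the exponential square moment. -/
theorem exp_le_add_exp_sq (x : ℝ) : Real.exp x ≤ x + Real.exp (x ^ 2) := by
  have h2 := Real.add_one_le_exp (x ^ 2)
  by_cases h : |x| ≤ 1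
  · have h1 := le_of_abs_le (Real.abs_exp_sub_one_sub_id_le h)
    linarith
  · rcases lt_abs.1 (not_le.1 h) with h | h
    · have : Real.exp x ≤ Real.exp (x ^ 2) := Real.exp_le_exp.2 (by nlinarith)
      linarith
    · have : Real.exp x ≤ 1 := Real.exp_le_one_iff.2 (by linarith)
      nlinarith

variable [IsProbabilityMeasure P]

/-- The moment generating function of a normalised square, at a negative argument. -/
theorem ExpSq.mgf_sq_le {U : Ω → ℝ} {T : ℝ} (hT : 0 < T) (h : ExpSq P U T)
    (h1 : ∫ ω, U ω ^ 2 ∂P = 1) :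
    mgf (fun ω => U ω ^ 2) P (-(1 / (4 * T ^ 4))) ≤ Real.exp (-(1 / (8 * T ^ 4))) := by
  -- A non-integrable function would have Bochner integral `0`, not `1`.
  have hint : Integrable (fun ω => U ω ^ 2) P := by
    by_contra hn
    rw [integral_undef hn] at h1
    exact zero_ne_one h1
  -- This `s` minimises the resulting bound `1 - s + 2 s² T⁴`.
  set s : ℝ := 1 / (4 * T ^ 4) with hs
  have hs0 : 0 < s := by positivity
  have hpt : ∀ ω, Real.exp (-s * U ω ^ 2) ≤
      1 - s * U ω ^ 2 + s ^ 2 * T ^ 4 * Real.exp (U ω ^ 2 / T ^ 2) := by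
    intro ω
    have e1 := exp_neg_le (x := s * U ω ^ 2) (by positivity)
    have e2 := Real.quadratic_le_exp_of_nonneg (x := U ω ^ 2 / T ^ 2) (by positivity)
    have e3 : (U ω ^ 2) ^ 2 ≤ 2 * T ^ 4 * Real.exp (U ω ^ 2 / T ^ 2) := by
      have e4 : (U ω ^ 2 / T ^ 2) ^ 2 / 2 ≤ Real.exp (U ω ^ 2 / T ^ 2) := by
        have : 0 ≤ U ω ^ 2 / T ^ 2 := by positivity
        linarith
      have e5 : (U ω ^ 2 / T ^ 2) ^ 2 / 2 = (U ω ^ 2) ^ 2 / (2 * T ^ 4) := by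
        field_simp
      rw [e5, div_le_iff₀ (by positivity)] at e4
      linarith
    rw [neg_mul]
    nlinarith [sq_nonneg s]
  calc mgf (fun ω => U ω ^ 2) P (-s)
      ≤ ∫ ω, (1 - s * U ω ^ 2 + s ^ 2 * T ^ 4 * Real.exp (U ω ^ 2 / T ^ 2)) ∂P := by
        refine integral_mono_of_nonneg (Filter.Eventually.of_forall fun ω => (Real.exp_pos _).le)
          (((integrable_const _).sub (hint.const_mul _)).add (h.integrable.const_mul _))
          (Filter.Eventually.of_forall hpt)
    _ = 1 - s + s ^ 2 * T ^ 4 * ∫ ω, Real.exp (U ω ^ 2 / T ^ 2) ∂P := by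
        rw [integral_add (by fun_prop) (h.integrable.const_mul _),
          integral_sub (integrable_const _) (hint.const_mul _),
          integral_const_mul, integral_const_mul, h1]
        simp
    _ ≤ 1 - s + s ^ 2 * T ^ 4 * 2 := by gcongr; exact h.integral_le
    _ = -(1 / (8 * T ^ 4)) + 1 := by rw [hs]; field_simp; ring
    _ ≤ _ := Real.add_one_le_exp _

/-- A centred random variable with an exponential square moment is sub-Gaussian. -/
theorem ExpSq.hasSubgaussianMGF {U : Ω → ℝ} (hU : Measurable U) {T : ℝ} (hT : 0 < T)
    (h : ExpSq P U T) (h0 : ∫ ω, U ω ∂P = 0) :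
    HasSubgaussianMGF U (2 * T.toNNReal ^ 2) P := by
  set f : Ω → ℝ := fun ω => Real.exp (U ω ^ 2 / T ^ 2) with hf
  have hUint : Integrable U P := by
    refine (h.integrable.const_mul T).mono' hU.aestronglyMeasurable
      (Filter.Eventually.of_forall fun ω => ?_)
    have e1 := Real.add_one_le_exp (U ω ^ 2 / T ^ 2)
    have e2 : |U ω| / T ≤ U ω ^ 2 / T ^ 2 + 1 := by
      have : U ω ^ 2 / T ^ 2 = (|U ω| / T) ^ 2 := by rw [div_pow, sq_abs]
      rw [this]
      nlinarith [sq_nonneg (|U ω| / T - 1)]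
    rw [Real.norm_eq_abs]
    calc |U ω| = T * (|U ω| / T) := by field_simp
      _ ≤ T * f ω := by gcongr; exact e2.trans e1
  -- Two uses of `2 a b ≤ a² + b²`: on the product `(t T) (U / T)`, then to replace `√f` by `(1 + f)
  -- / 2`. Centring plays no role here.
  have large : ∀ (t : ℝ) ω,
      Real.exp (t * U ω) ≤ Real.exp (t ^ 2 * T ^ 2 / 2) * ((1 + f ω) / 2) := by
    intro t ω
    have e1 : t * U ω ≤ t ^ 2 * T ^ 2 / 2 + U ω ^ 2 / T ^ 2 / 2 := by
      have : t * U ω = (t * T) * (U ω / T) := by field_simp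
      have h2 : U ω ^ 2 / T ^ 2 = (U ω / T) ^ 2 := by rw [div_pow]
      rw [this, h2]
      nlinarith [sq_nonneg (t * T - U ω / T)]
    have e2 : Real.exp (U ω ^ 2 / T ^ 2 / 2) ≤ (1 + f ω) / 2 := by
      have : f ω = Real.exp (U ω ^ 2 / T ^ 2 / 2) ^ 2 := by
        rw [hf, ← Real.exp_nat_mul]; push_cast; ring_nf
      rw [this]
      nlinarith [sq_nonneg (Real.exp (U ω ^ 2 / T ^ 2 / 2) - 1)]
    calc Real.exp (t * U ω) ≤ Real.exp (t ^ 2 * T ^ 2 / 2 + U ω ^ 2 / T ^ 2 / 2) :=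
          Real.exp_le_exp.2 e1
      _ = Real.exp (t ^ 2 * T ^ 2 / 2) * Real.exp (U ω ^ 2 / T ^ 2 / 2) := Real.exp_add _ _
      _ ≤ _ := by gcongr
  have hdom : ∀ t : ℝ, Integrable
      (fun ω => Real.exp (t ^ 2 * T ^ 2 / 2) * ((1 + f ω) / 2)) P := fun t =>
    (((integrable_const _).add h.integrable).div_const _).const_mul _
  have hexp : ∀ t : ℝ, Integrable (fun ω => Real.exp (t * U ω)) P := fun t =>
    (hdom t).mono' (by fun_prop) (Filter.Eventually.of_forall fun ω => by
      rw [Real.norm_eq_abs, abs_of_pos (Real.exp_pos _)]; exact large t ω)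
  refine ⟨hexp, fun t => ?_⟩
  have hc : ((2 * T.toNNReal ^ 2 : NNReal) : ℝ) * t ^ 2 / 2 = t ^ 2 * T ^ 2 := by
    push_cast
    rw [Real.coe_toNNReal _ hT.le]; ring
  rw [hc]
  set θ := t ^ 2 * T ^ 2 with hθ
  have hθ0 : 0 ≤ θ := by positivity
  -- For `θ ≤ 1` the linear term integrates to zero, and convexity of `exp` on `[0, U² / T²]` bounds
  -- the rest by `1 + θ`. For `θ ≥ 1` the crude bound `large` suffices.
  rcases le_total θ 1 with h1 | h1
  · have hpt : ∀ ω, Real.exp (t * U ω) ≤ t * U ω + ((1 - θ) + θ * f ω) := by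
      intro ω
      refine (exp_le_add_exp_sq _).trans ?_
      gcongr
      have e1 : (t * U ω) ^ 2 = (1 - θ) * 0 + θ * (U ω ^ 2 / T ^ 2) := by
        rw [hθ]; field_simp; simp
      have e2 := convexOn_exp.2 (Set.mem_univ 0) (Set.mem_univ (U ω ^ 2 / T ^ 2))
        (sub_nonneg.2 h1) hθ0 (by ring)
      rw [e1]
      simpa using e2
    calc mgf U P t ≤ ∫ ω, (t * U ω + ((1 - θ) + θ * f ω)) ∂P :=
          integral_mono (hexp t) ((hUint.const_mul _).add
            ((integrable_const _).add (h.integrable.const_mul _))) hpt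
      _ = 1 - θ + θ * ∫ ω, f ω ∂P := by
          have hfint : Integrable f P := h.integrable
          rw [integral_add (hUint.const_mul _) (by fun_prop),
            integral_add (integrable_const _) (hfint.const_mul _),
            integral_const_mul, integral_const_mul, h0]
          simp
      _ ≤ 1 - θ + θ * 2 := by gcongr; exact h.integral_le
      _ = θ + 1 := by ring
      _ ≤ Real.exp θ := Real.add_one_le_exp _
  · calc mgf U P t ≤ ∫ ω, Real.exp (θ / 2) * ((1 + f ω) / 2) ∂P :=
          integral_mono (hexp t) (hdom t) (large t)
      _ = Real.exp (θ / 2) * ((1 + ∫ ω, f ω ∂P) / 2) := by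
          have hfint : Integrable f P := h.integrable
          rw [integral_const_mul, integral_div, integral_add (integrable_const _) hfint]
          simp
      _ ≤ Real.exp (θ / 2) * (θ / 2 + 1) := by
          gcongr
          linarith [h.integral_le]
      _ ≤ Real.exp (θ / 2) * Real.exp (θ / 2) := by
          gcongr
          exact Real.add_one_le_exp _
      _ = Real.exp θ := by rw [← Real.exp_add]; congr 1; ring

/-- The Chernoff bound applied to `X` and `-X` at level `√(2 c' x)`. -/
theorem hasSubgaussianMGF_sq_tail {X : Ω → ℝ} {c c' : NNReal} (h : HasSubgaussianMGF X c P)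
    (hc : c ≤ c') {x : ℝ} (hx : 0 ≤ x) :
    P.real {ω | 2 * c' * x < X ω ^ 2} ≤ 2 * Real.exp (-x) := by
  have h' : HasSubgaussianMGF X c' P := ⟨h.integrable_exp_mul, fun t =>
    (h.mgf_le t).trans (Real.exp_le_exp.2 (by
      have : (c : ℝ) ≤ c' := by exact_mod_cast hc
      gcongr))⟩
  -- With proxy `0` the Chernoff exponent divides by zero. Then `X = 0` almost surely, and the
  -- strict inequality makes the event null.
  rcases eq_or_ne c' 0 with rfl | hc0
  · have h0 := HasSubgaussianMGF.ae_eq_zero_of_hasSubgaussianMGF_zero h'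
    have : P {ω | 2 * ((0 : NNReal) : ℝ) * x < X ω ^ 2} = 0 := by
      refine measure_mono_null ?_ h0
      intro ω hω (h2 : X ω = 0)
      simp [h2] at hω
    rw [Measure.real, this]
    simp [(Real.exp_pos _).le]
  · have hcpos : (0 : ℝ) < c' := by exact_mod_cast pos_iff_ne_zero.2 hc0
    set t := √(2 * c' * x)
    have ht : t ^ 2 = 2 * c' * x := Real.sq_sqrt (by positivity)
    have ht0 : 0 ≤ t := Real.sqrt_nonneg _
    have hexp : -t ^ 2 / (2 * c') = -x := by rw [ht]; field_simp
    have e1 := h'.measure_ge_le ht0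
    have e2 := h'.neg.measure_ge_le ht0
    rw [hexp] at e1 e2
    calc P.real {ω | 2 * c' * x < X ω ^ 2}
        ≤ P.real ({ω | t ≤ X ω} ∪ {ω | t ≤ (-X) ω}) := by
          refine measureReal_mono fun ω hω => ?_
          simp only [Set.mem_ofPred_eq, ← ht] at hω
          have := (sq_lt_sq.1 hω).le
          rw [abs_of_nonneg ht0] at this
          exact le_abs.1 this
      _ ≤ _ := measureReal_union_le _ _
      _ ≤ _ := by linarith

/-! ### Sums of independent squares -/

variable {n : ℕ} {U : Fin n → Ω → ℝ} {T : ℝ}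

/-- Chernoff at `1 / T²`: each factor is at most `2 ≤ e`, giving `exp (-2 n) * exp n`. -/
theorem measureReal_sum_sq_ge_le (hind : iIndepFun U P) (hU : ∀ i, Measurable (U i))
    (hT : 0 < T) (h : ∀ i, ExpSq P (U i) T) :
    P.real {ω | 2 * T ^ 2 * n ≤ ∑ i, U i ω ^ 2} ≤ Real.exp (-n) := by
  have hind' : iIndepFun (fun i ω => U i ω ^ 2) P :=
    hind.comp (fun _ x => x ^ 2) (fun _ => by fun_prop)
  have hm : ∀ i, Measurable (fun ω => U i ω ^ 2) := fun i => (hU i).pow_const 2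
  have hexp : ∀ i ω, Real.exp (1 / T ^ 2 * U i ω ^ 2) = Real.exp (U i ω ^ 2 / T ^ 2) :=
    fun i ω => by congr 1; ring
  have hint : Integrable (fun ω => Real.exp (1 / T ^ 2 * (∑ i, fun ω => U i ω ^ 2) ω)) P :=
    hind'.integrable_exp_mul_sum hm fun i _ => by simpa only [hexp] using (h i).integrable
  have h1 := measure_ge_le_exp_mul_mgf (2 * T ^ 2 * n) (t := 1 / T ^ 2) (by positivity) hint
  rw [hind'.mgf_sum hm] at h1
  simp only [Finset.sum_apply] at h1
  refine h1.trans ?_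
  have h2 : ∏ i : Fin n, mgf (fun ω => U i ω ^ 2) P (1 / T ^ 2) ≤ ∏ i : Fin n, Real.exp 1 := by
    refine Finset.prod_le_prod (fun i _ => mgf_nonneg) fun i _ => ?_
    have := (h i).integral_le
    simp only [mgf, hexp]
    linarith [Real.add_one_le_exp (1 : ℝ)]
  calc _ ≤ Real.exp (-(1 / T ^ 2) * (2 * T ^ 2 * n)) * ∏ i : Fin n, Real.exp 1 := by gcongr
    _ = Real.exp (-n) := by
      rw [Finset.prod_const, Finset.card_univ, Fintype.card_fin, ← Real.exp_nat_mul,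
        ← Real.exp_add]
      congr 1
      field_simp
      ring

/-- Chernoff at `-1 / (4 T⁴)`: the threshold contributes `n / (16 T⁴)` to the exponent and the
factors `-n / (8 T⁴)`. -/
theorem measureReal_sum_sq_le_le (hind : iIndepFun U P) (hU : ∀ i, Measurable (U i))
    (hT : 0 < T) (h : ∀ i, ExpSq P (U i) T) (h1 : ∀ i, ∫ ω, U i ω ^ 2 ∂P = 1) :
    P.real {ω | ∑ i, U i ω ^ 2 ≤ n / 4} ≤ Real.exp (-(1 / (16 * T ^ 4) * n)) := by
  have hind' : iIndepFun (fun i ω => U i ω ^ 2) P :=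
    hind.comp (fun _ x => x ^ 2) (fun _ => by fun_prop)
  have hm : ∀ i, Measurable (fun ω => U i ω ^ 2) := fun i => (hU i).pow_const 2
  have hint : Integrable
      (fun ω => Real.exp (-(1 / (4 * T ^ 4)) * (∑ i, fun ω => U i ω ^ 2) ω)) P := by
    refine hind'.integrable_exp_mul_sum hm fun i _ => ?_
    refine (integrable_const (1 : ℝ)).mono' (by fun_prop) (Filter.Eventually.of_forall fun ω => ?_)
    rw [Real.norm_eq_abs, abs_of_pos (Real.exp_pos _), Real.exp_le_one_iff, neg_mul,
      neg_nonpos]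
    positivity
  have h2 := measure_le_le_exp_mul_mgf (n / 4 : ℝ) (t := -(1 / (4 * T ^ 4)))
    (neg_nonpos.2 (by positivity)) hint
  rw [hind'.mgf_sum hm] at h2
  simp only [Finset.sum_apply] at h2
  refine h2.trans ?_
  have h3 : ∏ i : Fin n, mgf (fun ω => U i ω ^ 2) P (-(1 / (4 * T ^ 4))) ≤
      ∏ i : Fin n, Real.exp (-(1 / (8 * T ^ 4))) :=
    Finset.prod_le_prod (fun i _ => mgf_nonneg) fun i _ => (h i).mgf_sq_le hT (h1 i)
  calc _ ≤ Real.exp (- -(1 / (4 * T ^ 4)) * (n / 4)) *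
        ∏ i : Fin n, Real.exp (-(1 / (8 * T ^ 4))) := by gcongr
    _ = _ := by
      rw [Finset.prod_const, Finset.card_univ, Fintype.card_fin, ← Real.exp_nat_mul,
        ← Real.exp_add]
      congr 1
      field_simp
      ring

end Tail

/-! ### Concentration of random matrices with independent isotropic sub-Gaussian rows -/

/-- For a fixed unit vector both tails are at most `exp (-r n)`. The net has at most `(3 / δ) ^ K ≤
exp (r n / 2)` points when `n > C K`, so the union bound leaves `2 exp (-r n / 2) ≤ 4 / (r n)`. -/
theorem exists_random_matrix_bounds {T : ℝ} (hT : 0 < T) : ∃ C c : ℝ, 1 ≤ C ∧ 0 < c ∧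
    ∀ {Ω : Type*} [MeasurableSpace Ω] (P : Measure Ω) [IsProbabilityMeasure P] (n K : ℕ)
      (V : Fin n → Ω → Fin K → ℝ), (∀ i, Measurable (V i)) → iIndepFun V P →
      (∀ i (v : Fin K → ℝ), l2norm v = 1 → ExpSq P (fun ω => v ⬝ᵥ V i ω) T) →
      (∀ i (v : Fin K → ℝ), l2norm v = 1 → ∫ ω, (v ⬝ᵥ V i ω) ^ 2 ∂P = 1) →
      C * (K : ℝ) < (n : ℝ) →
      P.real {ω | ¬ ∀ v : Fin K → ℝ,
        (n / 16 : ℝ) * (v ⬝ᵥ v) ≤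
            (Matrix.of (fun i => V i ω) *ᵥ v) ⬝ᵥ (Matrix.of (fun i => V i ω) *ᵥ v) ∧
          (Matrix.of (fun i => V i ω) *ᵥ v) ⬝ᵥ (Matrix.of (fun i => V i ω) *ᵥ v) ≤
            8 * T ^ 2 * n * (v ⬝ᵥ v)} ≤ c / n := by
  -- The bound `1 / 2` is for the operator norm; `1 / (16 T)` makes the loss in the lower bound at
  -- most half of `lo`.
  obtain ⟨δ, hδ0, hδ1, hδ2⟩ : ∃ δ : ℝ, 0 < δ ∧ δ ≤ 1 / 2 ∧ δ ≤ 1 / (16 * T) :=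
    ⟨min (1 / 2) (1 / (16 * T)), by positivity, min_le_left _ _, min_le_right _ _⟩
  -- `r` is the smaller of the two Chernoff rates.
  obtain ⟨r, hr0, hr1, hr2⟩ : ∃ r : ℝ, 0 < r ∧ r ≤ 1 ∧ r ≤ 1 / (16 * T ^ 4) :=
    ⟨min 1 (1 / (16 * T ^ 4)), by positivity, min_le_left _ _, min_le_right _ _⟩
  have hlog : 0 < 3 / δ := by positivity
  -- The second entry of the maximum pays for the net; the entry `1` yields `K ≤ n`, needed later
  -- for the noise.
  refine ⟨max 1 (2 * Real.log (3 / δ) / r), 4 / r, le_max_left _ _, by positivity, ?_⟩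
  intro Ω _ P _ n K V hV hind hE h1 hn
  have hn0 : (0 : ℝ) < n := lt_of_le_of_lt (by positivity) hn
  obtain ⟨s, hcard, hunit, hnet⟩ :=
    exists_sphere_net (F := EuclideanSpace ℝ (Fin K)) hδ0 (hδ1.trans (by norm_num))
  rw [finrank_euclideanSpace, Fintype.card_fin] at hcard
  have hsq : ∀ (u : Fin K → ℝ) ω, l2norm (Matrix.of (fun i => V i ω) *ᵥ u) ^ 2 =
      ∑ i, (u ⬝ᵥ V i ω) ^ 2 := by
    intro u ω
    rw [l2norm_sq]
    simp only [dotProduct, sq, Matrix.mulVec, Matrix.of_apply]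
    simp only [mul_comm (u _)]
  set hi : ℝ := √(2 * T ^ 2 * n) with hhi
  set lo : ℝ := √(n / 4) with hlo
  have hhi2 : hi ^ 2 = 2 * T ^ 2 * n := Real.sq_sqrt (by positivity)
  have hlo2 : lo ^ 2 = n / 4 := Real.sq_sqrt (by positivity)
  have hhi0 : 0 ≤ hi := Real.sqrt_nonneg _
  have hlo0 : 0 ≤ lo := Real.sqrt_nonneg _
  have hgap : 2 * hi * δ ≤ lo / 2 := by
    refine le_of_sq_le_sq ?_ (by positivity)
    have e1 : (2 * hi * δ) ^ 2 = 8 * n * (T * δ) ^ 2 := by rw [mul_pow, mul_pow, hhi2]; ring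
    have e2 : T * δ ≤ 1 / 16 := by
      calc T * δ ≤ T * (1 / (16 * T)) := by gcongr
        _ = 1 / 16 := by field_simp
    have e3 : (T * δ) ^ 2 ≤ (1 / 16) ^ 2 := pow_le_pow_left₀ (by positivity) e2 2
    rw [e1, div_pow, hlo2]
    nlinarith
  have hsub : {ω | ¬ ∀ v : Fin K → ℝ,
        (n / 16 : ℝ) * (v ⬝ᵥ v) ≤
            (Matrix.of (fun i => V i ω) *ᵥ v) ⬝ᵥ (Matrix.of (fun i => V i ω) *ᵥ v) ∧
          (Matrix.of (fun i => V i ω) *ᵥ v) ⬝ᵥ (Matrix.of (fun i => V i ω) *ᵥ v) ≤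
            8 * T ^ 2 * n * (v ⬝ᵥ v)} ⊆
      ⋃ u ∈ s, ({ω | 2 * T ^ 2 * n ≤ ∑ i, (u.ofLp ⬝ᵥ V i ω) ^ 2} ∪
        {ω | ∑ i, (u.ofLp ⬝ᵥ V i ω) ^ 2 ≤ n / 4}) := by
    intro ω hω
    by_contra hcon
    simp only [Set.mem_iUnion, not_exists, Set.mem_union, Set.mem_ofPred_eq, not_or, not_le,
      ← hsq, ← hhi2, ← hlo2] at hcon
    refine hω fun v => ?_
    obtain ⟨b1, b2⟩ := bounds_of_net (Matrix.of (fun i => V i ω)) hδ1 hhi0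
      (hgap.trans (by linarith)) s hnet
      (fun u hu => le_of_sq_le_sq (hcon u hu).1.le hhi0)
      (fun u hu => le_of_sq_le_sq (hcon u hu).2.le (norm_nonneg _)) v
    have hv := dotProduct_self_nonneg v
    constructor
    · refine le_trans ?_ b1
      gcongr
      have : (lo / 2) ^ 2 ≤ (lo - 2 * hi * δ) ^ 2 :=
        pow_le_pow_left₀ (by positivity) (by linarith) 2
      rw [div_pow, hlo2] at this
      linarith
    · refine b2.trans_eq ?_
      rw [mul_pow, hhi2]; ring
  have hone : ∀ u ∈ s, P.real ({ω | 2 * T ^ 2 * n ≤ ∑ i, (u.ofLp ⬝ᵥ V i ω) ^ 2} ∪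
        {ω | ∑ i, (u.ofLp ⬝ᵥ V i ω) ^ 2 ≤ n / 4}) ≤ 2 * Real.exp (-(r * n)) := by
    intro u hu
    have hu1 : l2norm u.ofLp = 1 := hunit u hu
    have hmeas : ∀ i, Measurable (fun ω => u.ofLp ⬝ᵥ V i ω) := fun i => by
      have := hV i
      simp only [dotProduct]
      fun_prop
    have hind' : iIndepFun (fun i ω => u.ofLp ⬝ᵥ V i ω) P :=
      hind.comp (fun _ x => u.ofLp ⬝ᵥ x) (fun _ => by simp only [dotProduct]; fun_prop)
    have p1 := measureReal_sum_sq_ge_le hind' hmeas hT (fun i => hE i _ hu1)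
    have p2 := measureReal_sum_sq_le_le hind' hmeas hT (fun i => hE i _ hu1)
      (fun i => h1 i _ hu1)
    have q1 : Real.exp (-(n : ℝ)) ≤ Real.exp (-(r * n)) :=
      Real.exp_le_exp.2 (by nlinarith)
    have q2 : Real.exp (-(1 / (16 * T ^ 4) * n)) ≤ Real.exp (-(r * n)) :=
      Real.exp_le_exp.2 (by nlinarith)
    linarith [measureReal_union_le (μ := P) {ω | 2 * T ^ 2 * n ≤ ∑ i, (u.ofLp ⬝ᵥ V i ω) ^ 2}
        {ω | ∑ i, (u.ofLp ⬝ᵥ V i ω) ^ 2 ≤ n / 4}]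
  have hlogn : K * Real.log (3 / δ) ≤ r * n / 2 := by
    have e1 : 2 * Real.log (3 / δ) / r * K ≤ n :=
      (mul_le_mul_of_nonneg_right (le_max_right _ _) (by positivity)).trans hn.le
    have e2 : 2 * Real.log (3 / δ) / r * K = 2 * (K * Real.log (3 / δ)) / r := by ring
    rw [e2, div_le_iff₀ hr0] at e1
    linarith
  calc _ ≤ P.real _ := measureReal_mono hsub (measure_ne_top _ _)
    _ ≤ ∑ u ∈ s, P.real _ := measureReal_biUnion_finset_le _ _
    _ ≤ ∑ _u ∈ s, 2 * Real.exp (-(r * n)) := Finset.sum_le_sum hone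
    _ = s.card * (2 * Real.exp (-(r * n))) := by rw [Finset.sum_const, nsmul_eq_mul]
    _ ≤ Real.exp (r * n / 2) * (2 * Real.exp (-(r * n))) := by
      gcongr
      refine hcard.trans ?_
      rw [← Real.exp_log hlog, ← Real.exp_nat_mul]
      exact Real.exp_le_exp.2 hlogn
    _ = 2 * (Real.exp (r * n / 2))⁻¹ := by
      rw [← Real.exp_neg, mul_left_comm, ← Real.exp_add]
      congr 2; ring
    _ ≤ 2 * (r * n / 2)⁻¹ := by
      gcongr
      linarith [Real.add_one_le_exp (r * n / 2)]
    _ = 4 / r / n := by field_simp; norm_num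

/-! ### Second moments -/

section SecondMoments

variable {Ω : Type*} [MeasurableSpace Ω] {P : Measure Ω} {ι : Type*} [Fintype ι]

theorem memLp_dotProduct {W : Ω → ι → ℝ} (hW : ∀ i, MemLp (fun ω => W ω i) 2 P) (w : ι → ℝ) :
    MemLp (fun ω => w ⬝ᵥ W ω) 2 P :=
  memLp_finsetSum _ fun i _ => (hW i).const_mul (w i)

variable [IsProbabilityMeasure P]

theorem integral_dotProduct_eq_zero {W : Ω → ι → ℝ} (hW : ∀ i, MemLp (fun ω => W ω i) 2 P)
    (h0 : ∀ i, ∫ ω, W ω i ∂P = 0) (w : ι → ℝ) : ∫ ω, w ⬝ᵥ W ω ∂P = 0 := by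
  simp only [dotProduct]
  rw [integral_finsetSum _ fun i _ => ((hW i).integrable one_le_two).const_mul _]
  simp [integral_const_mul, h0]

theorem integral_dotProduct_sq {W : Ω → ι → ℝ} (hW : ∀ i, MemLp (fun ω => W ω i) 2 P)
    (h0 : ∀ i, ∫ ω, W ω i ∂P = 0) (w : ι → ℝ) :
    ∫ ω, (w ⬝ᵥ W ω) ^ 2 ∂P = w ⬝ᵥ (covMatrix P W *ᵥ w) := by
  have h1 := variance_of_integral_eq_zero (memLp_dotProduct hW w).aemeasurable
    (integral_dotProduct_eq_zero hW h0 w)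
  rw [← h1, ← covariance_self (memLp_dotProduct hW w).aemeasurable]
  simp only [dotProduct]
  rw [covariance_fun_sum_fun_sum (fun i => (hW i).const_mul (w i))
    (fun i => (hW i).const_mul (w i))]
  simp only [covariance_const_mul_left, covariance_const_mul_right, covMatrix, Matrix.mulVec,
    dotProduct, Matrix.of_apply, Finset.mul_sum]
  refine Finset.sum_congr rfl fun i _ => Finset.sum_congr rfl fun j _ => by ring

end SecondMoments

theorem rank_eq_iff_forall_mulVec_eq_zero {m K : ℕ} (B : Matrix (Fin m) (Fin K) ℝ) :
    B.rank = K ↔ ∀ v, B *ᵥ v = 0 → v = 0 := by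
  have h1 := B.mulVecLin.finrank_range_add_finrank_ker
  rw [Module.finrank_fin_fun] at h1
  change B.rank + _ = K at h1
  have h2 : (∀ v, B *ᵥ v = 0 → v = 0) ↔ LinearMap.ker B.mulVecLin = ⊥ := by
    rw [LinearMap.ker_eq_bot']; rfl
  rw [h2, ← Submodule.finrank_eq_zero (R := ℝ)]
  omega

namespace Model

variable {Ω : Type*} [MeasurableSpace Ω] {P : Measure Ω} {n p K : ℕ} (M : Model P n p K)

/-! ### Distribution of the observations -/

theorem identDistrib_Z (i : Option (Fin n)) : IdentDistrib (M.Z i) (M.Z none) P P :=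
  (M.identDistrib i).comp (u := Prod.fst) measurable_fst

theorem identDistrib_E (i : Option (Fin n)) : IdentDistrib (M.E i) (M.E none) P P :=
  (M.identDistrib i).comp (u := fun x : _ × _ × _ => x.2.1) (by fun_prop)

theorem identDistrib_ε (i : Option (Fin n)) : IdentDistrib (M.ε i) (M.ε none) P P :=
  (M.identDistrib i).comp (u := fun x : _ × _ × _ => x.2.2) (by fun_prop)

theorem memLp_Z_apply (k : Fin K) : MemLp (fun ω => M.Z none ω k) 2 P := M.memLp_Z.eval k

theorem memLp_ε_some (i : Option (Fin n)) : MemLp (M.ε i) 2 P :=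
  (M.identDistrib_ε i).memLp_iff.2 M.memLp_ε

theorem integral_ε (i : Option (Fin n)) : ∫ ω, M.ε i ω ∂P = 0 :=
  (M.identDistrib_ε i).integral_eq.trans M.mean_ε

theorem integral_dotProduct_Z_sq [IsProbabilityMeasure P] (w : Fin K → ℝ) :
    ∫ ω, (w ⬝ᵥ M.Z none ω) ^ 2 ∂P = w ⬝ᵥ (M.covZ *ᵥ w) :=
  integral_dotProduct_sq M.memLp_Z_apply M.mean_Z w

theorem integral_ε_sq : ∫ ω, M.ε none ω ^ 2 ∂P = M.noiseVar :=
  (variance_of_integral_eq_zero M.memLp_ε.aemeasurable M.mean_ε).symm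

/-- Only the diagonal of `Σ_E` matters: a centred variable of variance zero vanishes almost surely.
-/
theorem ae_E_none_eq_zero (hE : M.covE = 0) : ∀ᵐ ω ∂P, M.E none ω = 0 := by
  have h : ∀ j, ∀ᵐ ω ∂P, M.E none ω j = 0 := by
    intro j
    have hL : MemLp (fun ω => M.E none ω j) 2 P := M.memLp_E.eval j
    have h1 : Var[fun ω => M.E none ω j; P] = 0 := by
      rw [← covariance_self hL.aemeasurable]
      exact congrFun (congrFun hE j) j
    rw [variance_of_integral_eq_zero hL.aemeasurable (M.mean_E j),
      integral_eq_zero_iff_of_nonneg (fun ω => sq_nonneg _) hL.integrable_sq] at h1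
    filter_upwards [h1] with ω hω
    simpa using hω
  filter_upwards [ae_all_iff.2 h] with ω hω
  exact funext hω

theorem ae_E_eq_zero (hE : M.covE = 0) : ∀ᵐ ω ∂P, ∀ i, M.E i ω = 0 := by
  rw [ae_all_iff]
  exact fun i => (M.identDistrib_E i).symm.ae_mem_snd (t := {0}) (measurableSet_singleton _)
    (M.ae_E_none_eq_zero hE)

theorem dataX_eq {ω : Ω} (hω : ∀ i, M.E i ω = 0) : M.dataX ω = M.dataZ ω * M.Aᵀ := by
  ext i j
  simp [dataX, dataZ, X, hω, Matrix.mul_apply, Matrix.mulVec, dotProduct, mul_comm]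

/-- The risk of a linear predictor, in terms of the induced coefficients of the factors. -/
theorem integral_oracle_risk [IsProbabilityMeasure P] (u : Fin K → ℝ) :
    ∫ ω, (M.Z none ω ⬝ᵥ u - M.y none ω) ^ 2 ∂P =
      (u - M.β) ⬝ᵥ (M.covZ *ᵥ (u - M.β)) + M.noiseVar := by
  set w := u - M.β with hw
  have hZ : MemLp (fun ω => w ⬝ᵥ M.Z none ω) 2 P := memLp_dotProduct M.memLp_Z_apply w
  have hind : IndepFun (fun ω => w ⬝ᵥ M.Z none ω) (M.ε none) P :=
    M.indep_Z.comp (φ := fun x => w ⬝ᵥ x) (ψ := Prod.snd)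
      (by simp only [dotProduct]; fun_prop) measurable_snd
  have hcross : ∫ ω, (w ⬝ᵥ M.Z none ω) * M.ε none ω ∂P = 0 := by
    rw [hind.integral_fun_mul_eq_mul_integral hZ.aestronglyMeasurable
      M.memLp_ε.aestronglyMeasurable, M.mean_ε, mul_zero]
  have hint : Integrable (fun ω => (w ⬝ᵥ M.Z none ω) * M.ε none ω) P :=
    hZ.integrable_mul M.memLp_ε
  have hpt : ∀ ω, (M.Z none ω ⬝ᵥ u - M.y none ω) ^ 2 = (w ⬝ᵥ M.Z none ω) ^ 2 -
      2 * ((w ⬝ᵥ M.Z none ω) * M.ε none ω) + M.ε none ω ^ 2 := by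
    intro ω
    have : M.Z none ω ⬝ᵥ u - M.y none ω = w ⬝ᵥ M.Z none ω - M.ε none ω := by
      rw [y, hw, dotProduct_comm (u - M.β), dotProduct_sub]; ring
    rw [this]; ring
  simp only [hpt]
  have hZ2 := hZ.integrable_sq
  rw [integral_add (by fun_prop) M.memLp_ε.integrable_sq,
    integral_sub hZ2 (hint.const_mul 2), integral_const_mul, hcross,
    M.integral_dotProduct_Z_sq, M.integral_ε_sq]
  ring

theorem risk_eq_oracle (hE : M.covE = 0) (α : Fin p → ℝ) :
    M.risk α = ∫ ω, (M.Z none ω ⬝ᵥ (M.Aᵀ *ᵥ α) - M.y none ω) ^ 2 ∂P := by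
  refine integral_congr_ae ?_
  filter_upwards [M.ae_E_none_eq_zero hE] with ω hω
  simp only [X, hω, add_zero]
  rw [Matrix.mulVec_transpose, dotProduct_comm _ α, Matrix.dotProduct_mulVec,
    dotProduct_comm (M.Z none ω)]

/-! ### The estimator -/

/-- The normal equations for `B Aᵀ` carry an extra factor `A` on the left, which full column rank
cancels. -/
theorem transpose_dataZ_mulVec_eq_zero (hA : M.A.rank = K) {B : Matrix (Fin n) (Fin K) ℝ}
    {y : Fin n → ℝ} {α : Fin p → ℝ} (h : IsLeastSquares (B * M.Aᵀ) y α) :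
    Bᵀ *ᵥ (B *ᵥ (M.Aᵀ *ᵥ α) - y) = 0 := by
  have h1 := h.transpose_mulVec_eq_zero
  rw [Matrix.transpose_mul, Matrix.transpose_transpose, ← Matrix.mulVec_mulVec,
    ← Matrix.mulVec_mulVec] at h1
  exact (rank_eq_iff_forall_mulVec_eq_zero _).1 hA _ h1

theorem transpose_mulVec_αHat {ω : Ω} (hA : M.A.rank = K) (hω : ∀ i, M.E i ω = 0)
    (hZ : (M.dataZ ω).rank = K) : M.Aᵀ *ᵥ M.αHat ω = M.βHat ω := by
  have hB := (rank_eq_iff_forall_mulVec_eq_zero _).1 hZ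
  have h1 := (minNormLS_spec (M.dataX ω) (M.dataY ω)).1
  rw [M.dataX_eq hω] at h1
  have h2 := M.transpose_dataZ_mulVec_eq_zero hA h1
  rw [← M.dataX_eq hω] at h2
  exact (eq_leftInv_mulVec hB h2).trans
    (eq_leftInv_mulVec hB (transpose_mulVec_pinv_sub_eq_zero _ _)).symm

theorem prediction_eq (hE : M.covE = 0) (hM : M.FullRank) :
    ∀ᵐ ω ∂P, (M.dataZ ω).rank = K →
      M.X none ω ⬝ᵥ M.αHat ω = M.Z none ω ⬝ᵥ M.βHat ω ∧
      M.risk (M.αHat ω) = ∫ ω', (M.Z none ω' ⬝ᵥ M.βHat ω - M.y none ω') ^ 2 ∂P := by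
  filter_upwards [M.ae_E_eq_zero hE] with ω hω hZ
  have h := M.transpose_mulVec_αHat hM.1 hω hZ
  refine ⟨?_, by rw [M.risk_eq_oracle hE, h]⟩
  rw [← h, X, hω, add_zero, Matrix.mulVec_transpose, dotProduct_comm (M.A *ᵥ _),
    Matrix.dotProduct_mulVec, dotProduct_comm]

/-! ### Whitened factors -/

/-- The factors `S⁻¹ Z_i`, whitened by a square root `S` of their covariance matrix. -/
noncomputable def whitened (S : Matrix (Fin K) (Fin K) ℝ) (i : Option (Fin n)) (ω : Ω) :
    Fin K → ℝ :=
  S⁻¹ *ᵥ M.Z i ω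

/-- The matrix with rows the whitened training factors. -/
noncomputable def whitenedData (S : Matrix (Fin K) (Fin K) ℝ) (ω : Ω) :
    Matrix (Fin n) (Fin K) ℝ :=
  Matrix.of fun i => M.whitened S (some i) ω

variable {S : Matrix (Fin K) (Fin K) ℝ}

theorem isUnit_sqrt (hM : M.FullRank) (hSS : S * S = M.covZ) : IsUnit S.det := by
  rw [← Matrix.isUnit_iff_isUnit_det, ← Matrix.mulVec_injective_iff_isUnit]
  refine (injective_iff_map_eq_zero (Matrix.mulVecLin S)).2 fun v hv => ?_
  refine (rank_eq_iff_forall_mulVec_eq_zero _).1 hM.2 v ?_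
  rw [Matrix.mulVecLin_apply] at hv
  rw [← hSS, ← Matrix.mulVec_mulVec, hv, Matrix.mulVec_zero]

theorem dataZ_eq_whitenedData_mul (hS : IsUnit S.det) (hsymm : Sᵀ = S) (ω : Ω) :
    M.dataZ ω = M.whitenedData S ω * S := by
  ext i j
  have h1 : M.Z (some i) ω = S *ᵥ M.whitened S (some i) ω := by
    rw [whitened, Matrix.mulVec_mulVec, Matrix.mul_nonsing_inv _ hS, Matrix.one_mulVec]
  change M.Z (some i) ω j = (M.whitened S (some i) ω ᵥ* S) j
  rw [h1, ← Matrix.mulVec_transpose, hsymm]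

theorem measurable_whitened (S : Matrix (Fin K) (Fin K) ℝ) (i : Option (Fin n)) :
    Measurable (M.whitened S i) := by
  have := M.measurable_Z i
  refine measurable_pi_iff.2 fun k => ?_
  simp only [whitened, Matrix.mulVec, dotProduct]
  fun_prop

/-- The excess risk of the estimator is a squared linear image of the training noise. -/
theorem risk_minNormLS [IsProbabilityMeasure P] (hE : M.covE = 0) (hM : M.FullRank)
    (hSS : S * S = M.covZ) (hsymm : Sᵀ = S) {ω : Ω} (hω : ∀ i, M.E i ω = 0)
    (hV : ∀ v, M.whitenedData S ω *ᵥ v = 0 → v = 0) (e : Fin n → ℝ) :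
    M.risk (minNormLS (M.dataX ω) (M.dataZ ω *ᵥ M.β + e)) =
      ∑ k, (leftInv (M.whitenedData S ω) k ⬝ᵥ e) ^ 2 + M.noiseVar := by
  have hS := M.isUnit_sqrt hM hSS
  set V := M.whitenedData S ω with hVdef
  set α := minNormLS (M.dataX ω) (M.dataZ ω *ᵥ M.β + e) with hα
  have h1 := (minNormLS_spec (M.dataX ω) (M.dataZ ω *ᵥ M.β + e)).1
  rw [← hα, M.dataX_eq hω] at h1
  have h2 := M.transpose_dataZ_mulVec_eq_zero hM.1 h1
  have hdata : M.dataZ ω = V * S := M.dataZ_eq_whitenedData_mul hS hsymm ω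
  have h3 : M.dataZ ω *ᵥ (M.Aᵀ *ᵥ α) - (M.dataZ ω *ᵥ M.β + e) =
      V *ᵥ (S *ᵥ (M.Aᵀ *ᵥ α - M.β)) - e := by
    rw [Matrix.mulVec_mulVec _ V S, ← hdata, Matrix.mulVec_sub]; abel
  rw [h3, hdata, Matrix.transpose_mul, ← Matrix.mulVec_mulVec, hsymm] at h2
  -- Cancelling the invertible `S` shows that the whitened error solves the least-squares problem
  -- with design `V` and response `e`.
  have h4 : Vᵀ *ᵥ (V *ᵥ (S *ᵥ (M.Aᵀ *ᵥ α - M.β)) - e) = 0 :=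
    Matrix.mulVec_injective_iff_isUnit.2 ((Matrix.isUnit_iff_isUnit_det S).2 hS)
      (h2.trans (Matrix.mulVec_zero S).symm)
  have h5 := eq_leftInv_mulVec hV h4
  rw [M.risk_eq_oracle hE, M.integral_oracle_risk, ← hSS]
  congr 1
  -- Reading `S * S` as `Sᵀ * S` turns the quadratic form into the squared norm of the whitened
  -- error.
  nth_rewrite 1 [← hsymm]
  rw [dotProduct_transpose_mul_mulVec, h5]
  simp [dotProduct, Matrix.mulVec, sq]

end Model
/-! ### Independence of the training factors and the training noise -/

section Independence

variable {Ω : Type*} [MeasurableSpace Ω] {P : Measure Ω} [IsProbabilityMeasure P]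
  {α β : Type*} [MeasurableSpace α] [MeasurableSpace β]

/-- The joint law is a product over `i` of products of two laws; regrouping the factors makes it a
product of two product measures. -/
theorem indepFun_pi_pi {ι : Type*} [Fintype ι] {f : ι → Ω → α} {g : ι → Ω → β}
    (hf : ∀ i, Measurable (f i)) (hg : ∀ i, Measurable (g i))
    (h : iIndepFun (fun i ω => (f i ω, g i ω)) P) (hfg : ∀ i, IndepFun (f i) (g i) P) :
    IndepFun (fun ω i => f i ω) (fun ω i => g i ω) P := by
  have hf' : Measurable (fun ω i => f i ω) := measurable_pi_iff.2 hf
  have hg' : Measurable (fun ω i => g i ω) := measurable_pi_iff.2 hg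
  have : ∀ i, IsProbabilityMeasure (P.map (f i)) :=
    fun i => Measure.isProbabilityMeasure_map (hf i).aemeasurable
  have : ∀ i, IsProbabilityMeasure (P.map (g i)) :=
    fun i => Measure.isProbabilityMeasure_map (hg i).aemeasurable
  have h1 : iIndepFun f P := h.comp (fun _ => Prod.fst) (fun _ => measurable_fst)
  have h2 : iIndepFun g P := h.comp (fun _ => Prod.snd) (fun _ => measurable_snd)
  have e1 := (iIndepFun_iff_map_fun_eq_pi_map fun i => (hf i).aemeasurable).1 h1
  have e2 := (iIndepFun_iff_map_fun_eq_pi_map fun i => (hg i).aemeasurable).1 h2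
  have e3 := (iIndepFun_iff_map_fun_eq_pi_map
    fun i => ((hf i).prodMk (hg i)).aemeasurable).1 h
  have e4 : ∀ i, P.map (fun ω => (f i ω, g i ω)) = (P.map (f i)).prod (P.map (g i)) := fun i =>
    (indepFun_iff_map_prod_eq_prod_map_map (hf i).aemeasurable (hg i).aemeasurable).1 (hfg i)
  simp only [e4] at e3
  rw [indepFun_iff_map_prod_eq_prod_map_map hf'.aemeasurable hg'.aemeasurable, e1, e2,
    ← (measurePreserving_arrowProdEquivProdArrow α β ι _ _).map_eq, ← e3,
    Measure.map_map (MeasurableEquiv.measurable _)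
      (measurable_pi_iff.2 fun i => (hf i).prodMk (hg i))]
  rfl

/-- A uniform bound on the sections of an event bounds its probability. -/
theorem IndepFun.measureReal_le_of_sections {f : Ω → α} {g : Ω → β} (hf : Measurable f)
    (hg : Measurable g) (h : IndepFun f g P) {s : Set (α × β)} (hs : MeasurableSet s) {q : ℝ}
    (hq : 0 ≤ q) (hb : ∀ x, P.real {ω | (x, g ω) ∈ s} ≤ q) :
    P.real {ω | (f ω, g ω) ∈ s} ≤ q := by
  have : IsProbabilityMeasure (P.map f) := Measure.isProbabilityMeasure_map hf.aemeasurable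
  have : IsProbabilityMeasure (P.map g) := Measure.isProbabilityMeasure_map hg.aemeasurable
  have e1 : P {ω | (f ω, g ω) ∈ s} = (P.map fun ω => (f ω, g ω)) s :=
    (Measure.map_apply (hf.prodMk hg) hs).symm
  have e2 : ∀ x, (P.map g) (Prod.mk x ⁻¹' s) ≤ ENNReal.ofReal q := by
    intro x
    rw [Measure.map_apply hg (measurable_prodMk_left hs)]
    exact (ENNReal.le_ofReal_iff_toReal_le (measure_ne_top _ _) hq).2 (hb x)
  refine ENNReal.toReal_le_of_le_ofReal hq ?_
  rw [e1, (indepFun_iff_map_prod_eq_prod_map_map hf.aemeasurable hg.aemeasurable).1 h,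
    Measure.prod_apply hs]
  calc _ ≤ ∫⁻ _x, ENNReal.ofReal q ∂(P.map f) := lintegral_mono e2
    _ = ENNReal.ofReal q := by simp

/-- Conditioning on `f` freezes the direction. The norm constraint belongs to the event because the
tail bound is uniform only over short vectors; elsewhere the section is empty. -/
theorem measureReal_and_lt_dotProduct_sq_le {ι : Type*} [Fintype ι] {f : Ω → α}
    {g : Ω → ι → ℝ} (hf : Measurable f) (hg : Measurable g) (h : IndepFun f g P) {G : α → ι → ℝ}
    (hG : Measurable G) {d t q : ℝ} (hq : 0 ≤ q)
    (hb : ∀ w : ι → ℝ, w ⬝ᵥ w ≤ d → P.real {ω | t < (w ⬝ᵥ g ω) ^ 2} ≤ q) :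
    P.real {ω | G (f ω) ⬝ᵥ G (f ω) ≤ d ∧ t < (G (f ω) ⬝ᵥ g ω) ^ 2} ≤ q := by
  have hs : MeasurableSet ({z : α × (ι → ℝ) | G z.1 ⬝ᵥ G z.1 ≤ d} ∩
      {z | t < (G z.1 ⬝ᵥ z.2) ^ 2}) := by
    refine MeasurableSet.inter (measurableSet_le ?_ measurable_const)
      (measurableSet_lt measurable_const ?_)
    · simp only [dotProduct]; fun_prop
    · simp only [dotProduct]; fun_prop
  refine IndepFun.measureReal_le_of_sections hf hg h hs hq fun y => ?_
  by_cases hy : G y ⬝ᵥ G y ≤ d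
  · exact (measureReal_mono fun ω hω => hω.2).trans (hb _ hy)
  · have : {ω | (y, g ω) ∈ {z : α × (ι → ℝ) | G z.1 ⬝ᵥ G z.1 ≤ d} ∩
        {z | t < (G z.1 ⬝ᵥ z.2) ^ 2}} = ∅ := Set.eq_empty_of_forall_notMem fun ω hω => hy hω.1
    rw [this, measureReal_empty]
    exact hq

end Independence

theorem hasSubgaussianMGF_const_mul {Ω : Type*} [MeasurableSpace Ω] {P : Measure Ω} {X : Ω → ℝ}
    {c : NNReal} (h : HasSubgaussianMGF X c P) (r : ℝ) :
    HasSubgaussianMGF (fun ω => r * X ω) ((r ^ 2).toNNReal * c) P := by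
  rw [Real.toNNReal_of_nonneg (sq_nonneg r)]
  exact h.const_mul r

/-- The inverse is the adjugate times the inverse determinant. Inversion on `ℝ`, with `0⁻¹ = 0`, is
measurable, so singular designs need no exclusion. -/
theorem measurable_leftInv {n K : ℕ} (k : Fin K) (i : Fin n) :
    Measurable fun x : Fin n → Fin K → ℝ => leftInv (Matrix.of x) k i := by
  have hG : Continuous fun x : Fin n → Fin K → ℝ => (Matrix.of x)ᵀ * Matrix.of x := by
    refine continuous_matrix fun a b => ?_
    simp only [Matrix.mul_apply, Matrix.transpose_apply, Matrix.of_apply]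
    fun_prop
  have hadj : ∀ a b, Measurable fun x : Fin n → Fin K → ℝ =>
      ((Matrix.of x)ᵀ * Matrix.of x).adjugate a b := fun a b =>
    (hG.matrix_adjugate.matrix_elem a b).measurable
  have hdet : Measurable fun x : Fin n → Fin K → ℝ => ((Matrix.of x)ᵀ * Matrix.of x).det :=
    hG.matrix_det.measurable
  simp only [leftInv, Matrix.inv_def, Ring.inverse_eq_inv', Matrix.smul_mul, Matrix.smul_apply,
    smul_eq_mul, Matrix.mul_apply (M := Matrix.adjugate _), Matrix.transpose_apply,
    Matrix.of_apply]
  fun_prop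

namespace Model

variable {Ω : Type*} [MeasurableSpace Ω] {P : Measure Ω} {n p K : ℕ}
  (M : Model P n p K) {S : Matrix (Fin K) (Fin K) ℝ}

theorem noiseVar_nonneg : 0 ≤ M.noiseVar := variance_nonneg _ _

theorem iIndepFun_ε : iIndepFun (fun (i : Fin n) => M.ε (some i)) P :=
  (M.iIndep.precomp (Option.some_injective _)).comp (fun _ x => x.2.2) (fun _ => by fun_prop)

theorem iIndepFun_whitened (S : Matrix (Fin K) (Fin K) ℝ) :
    iIndepFun (fun (i : Fin n) => M.whitened S (some i)) P :=
  (M.iIndep.precomp (Option.some_injective _)).comp (fun _ x => S⁻¹ *ᵥ x.1)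
    (fun _ => measurable_pi_iff.2 fun k => by simp only [Matrix.mulVec, dotProduct]; fun_prop)

theorem measurable_dataε : Measurable M.dataε :=
  measurable_pi_iff.2 fun i => M.measurable_ε (some i)

theorem indepFun_Z_ε [IsProbabilityMeasure P] (i : Option (Fin n)) : IndepFun (M.Z i) (M.ε i) P := by
  have h0 : IndepFun (M.Z none) (M.ε none) P :=
    M.indep_Z.comp (φ := id) (ψ := Prod.snd) measurable_id measurable_snd
  have hid : IdentDistrib (fun ω => (M.Z none ω, M.ε none ω)) (fun ω => (M.Z i ω, M.ε i ω)) P P :=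
    ((M.identDistrib i).comp (u := fun x : _ × _ × _ => (x.1, x.2.2)) (by fun_prop)).symm
  exact indepFun_of_identDistrib_pair h0 hid

theorem indepFun_whitened_dataε [IsProbabilityMeasure P] (S : Matrix (Fin K) (Fin K) ℝ) :
    IndepFun (fun ω (i : Fin n) => M.whitened S (some i) ω) M.dataε P := by
  have hm : Measurable fun x : Fin K → ℝ => S⁻¹ *ᵥ x :=
    measurable_pi_iff.2 fun k => by simp only [Matrix.mulVec, dotProduct]; fun_prop
  refine indepFun_pi_pi (fun i => M.measurable_whitened S (some i))
    (fun i => M.measurable_ε (some i)) ?_ fun i => ?_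
  · exact (M.iIndep.precomp (Option.some_injective _)).comp (fun _ x => (S⁻¹ *ᵥ x.1, x.2.2))
      (fun _ => (hm.comp measurable_fst).prodMk (by fun_prop))
  · exact (M.indepFun_Z_ε (some i)).comp (φ := fun x => S⁻¹ *ᵥ x) (ψ := id) hm measurable_id

/-! ### The training noise -/

theorem integral_dotProduct_dataε_sq [IsProbabilityMeasure P] (w : Fin n → ℝ) :
    ∫ ω, (w ⬝ᵥ M.dataε ω) ^ 2 ∂P = M.noiseVar * (w ⬝ᵥ w) := by
  rw [integral_dotProduct_sq (W := M.dataε) (fun i => M.memLp_ε_some (some i))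
    (fun i => M.integral_ε (some i))]
  have hcov : covMatrix P M.dataε = M.noiseVar • (1 : Matrix (Fin n) (Fin n) ℝ) := by
    ext i j
    rw [Matrix.smul_apply, smul_eq_mul]
    change cov[M.ε (some i), M.ε (some j); P] = _
    by_cases hij : i = j
    · subst hij
      rw [Matrix.one_apply_eq, mul_one, covariance_self (M.measurable_ε _).aemeasurable]
      exact (M.identDistrib_ε (some i)).variance_eq
    · rw [Matrix.one_apply_ne hij, mul_zero]
      exact (M.iIndepFun_ε.indepFun hij).covariance_eq_zero (M.memLp_ε_some _)
        (M.memLp_ε_some _)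
  rw [hcov, Matrix.smul_mulVec, Matrix.one_mulVec, dotProduct_smul, smul_eq_mul]

theorem hasSubgaussianMGF_ε [IsProbabilityMeasure P] {L T : ℝ}
    (hM : M.IsSubGaussian L) (hT : 0 < T) (hLT : L < T)
    (i : Option (Fin n)) :
    HasSubgaussianMGF (M.ε i) (M.noiseVar.toNNReal * (2 * T.toNNReal ^ 2)) P := by
  obtain ⟨-, εt, hmeas, hε, h0, hpsi⟩ := hM
  have h1 := hasSubgaussianMGF_const_mul
    ((expSq_of_psi2Norm_le hmeas hLT hT hpsi).hasSubgaussianMGF hmeas hT h0) (√M.noiseVar)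
  rw [Real.sq_sqrt M.noiseVar_nonneg] at h1
  exact (h1.congr (hε.mono fun ω h => h.symm)).congr_identDistrib (M.identDistrib_ε i).symm

/-- Independence adds the variance proxies, for a total of `2 T² σ_ε² ‖w‖²`. An upper bound `d`
replaces `‖w‖²` because only such a bound is available for the random rows. -/
theorem measureReal_dotProduct_dataε_sq_le [IsProbabilityMeasure P] {L T : ℝ}
    (hM : M.IsSubGaussian L) (hT : 0 < T)
    (hLT : L < T) (w : Fin n → ℝ) {d x : ℝ} (hw : w ⬝ᵥ w ≤ d) (hx : 0 ≤ x) :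
    P.real {ω | 4 * T ^ 2 * M.noiseVar * d * x < (w ⬝ᵥ M.dataε ω) ^ 2} ≤
      2 * Real.exp (-x) := by
  have hd : 0 ≤ d := (dotProduct_self_nonneg w).trans hw
  set c : NNReal := M.noiseVar.toNNReal * (2 * T.toNNReal ^ 2) with hc
  have hind : iIndepFun (fun (i : Fin n) ω => w i * M.ε (some i) ω) P :=
    M.iIndepFun_ε.comp (fun i x => w i * x) (fun i => by fun_prop)
  have h1 := HasSubgaussianMGF.sum_of_iIndepFun hind (s := Finset.univ)
    fun i _ => hasSubgaussianMGF_const_mul (M.hasSubgaussianMGF_ε hM hT hLT (some i)) (w i)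
  have h2 := hasSubgaussianMGF_sq_tail h1 (c' := c * d.toNNReal) ?_ hx
  · have hc' : 2 * ((c * d.toNNReal : NNReal) : ℝ) * x = 4 * T ^ 2 * M.noiseVar * d * x := by
      rw [NNReal.coe_mul, hc, NNReal.coe_mul, Real.coe_toNNReal _ M.noiseVar_nonneg,
        Real.coe_toNNReal _ hd]
      push_cast
      rw [Real.coe_toNNReal _ hT.le]
      ring
    rw [hc'] at h2
    exact h2
  · rw [← Finset.sum_mul, mul_comm c]
    gcongr
    rw [← NNReal.coe_le_coe, Real.coe_toNNReal _ hd, NNReal.coe_sum]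
    refine le_trans (le_of_eq ?_) hw
    exact Finset.sum_congr rfl fun i _ => by
      rw [Real.coe_toNNReal _ (sq_nonneg _), sq]

/-- Conditionally on the factors, the squared coordinates of the image of the noise under the
left inverse of the whitened factors are of order `log n / n`. -/
theorem measureReal_leftInv_dataε_le [IsProbabilityMeasure P] {L T : ℝ}
    (hM : M.IsSubGaussian L) (hT : 0 < T) (hLT : L < T) (S : Matrix (Fin K) (Fin K) ℝ) {d x : ℝ}
    (hx : 0 ≤ x) (k : Fin K) :
    P.real {ω | leftInv (M.whitenedData S ω) k ⬝ᵥ leftInv (M.whitenedData S ω) k ≤ d ∧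
      4 * T ^ 2 * M.noiseVar * d * x < (leftInv (M.whitenedData S ω) k ⬝ᵥ M.dataε ω) ^ 2} ≤
      2 * Real.exp (-x) :=
  measureReal_and_lt_dotProduct_sq_le (f := fun ω (i : Fin n) => M.whitened S (some i) ω)
    (measurable_pi_iff.2 fun i => M.measurable_whitened S (some i)) M.measurable_dataε
    (M.indepFun_whitened_dataε S) (G := fun x => leftInv (Matrix.of x) k)
    (measurable_pi_iff.2 fun i => measurable_leftInv k i) (by positivity)
    fun _ hw => M.measureReal_dotProduct_dataε_sq_le hM hT hLT _ hw hx

/-! ### The whitened factors are isotropic and sub-Gaussian -/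

theorem whitened_isotropic [IsProbabilityMeasure P] (hM : M.FullRank)
    (hSS : S * S = M.covZ) (hsymm : Sᵀ = S)
    (i : Option (Fin n)) {v : Fin K → ℝ} (hv : l2norm v = 1) :
    ∫ ω, (v ⬝ᵥ M.whitened S i ω) ^ 2 ∂P = 1 := by
  have hS := M.isUnit_sqrt hM hSS
  have hid : IdentDistrib (fun ω => (v ⬝ᵥ M.whitened S i ω) ^ 2)
      (fun ω => (v ⬝ᵥ M.whitened S none ω) ^ 2) P P :=
    (M.identDistrib_Z i).comp (u := fun x => (v ⬝ᵥ (S⁻¹ *ᵥ x)) ^ 2)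
      (by simp only [Matrix.mulVec, dotProduct]; fun_prop)
  have hinv : (S⁻¹)ᵀ = S⁻¹ := by rw [Matrix.transpose_nonsing_inv, hsymm]
  have h1 : ∀ ω, v ⬝ᵥ M.whitened S none ω = (S⁻¹ *ᵥ v) ⬝ᵥ M.Z none ω := fun ω => by
    rw [whitened, Matrix.dotProduct_mulVec, ← Matrix.mulVec_transpose, hinv]
  rw [hid.integral_eq]
  simp only [h1]
  rw [M.integral_dotProduct_Z_sq, ← hSS, show S * S = Sᵀ * S by rw [hsymm],
    dotProduct_transpose_mul_mulVec, Matrix.mulVec_mulVec, Matrix.mul_nonsing_inv _ hS,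
    Matrix.one_mulVec, ← l2norm_sq, hv, one_pow]

/-- Whitening recovers `Z̃` almost surely, so the scale `T` does not depend on `Σ_Z`. -/
theorem whitened_expSq (hS : IsUnit S.det) {L T : ℝ} (hT : 0 < T) (hLT : L < T)
    {Zt : Ω → Fin K → ℝ} (hZt : ∀ᵐ ω ∂P, M.Z none ω = S *ᵥ Zt ω) (hm : Measurable Zt)
    (hpsi : psi2NormVec P Zt ≤ ENNReal.ofReal L) (i : Option (Fin n)) {v : Fin K → ℝ}
    (hv : l2norm v = 1) : ExpSq P (fun ω => v ⬝ᵥ M.whitened S i ω) T := by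
  have h1 : ExpSq P (fun ω => v ⬝ᵥ Zt ω) T := by
    refine expSq_of_psi2Norm_le (by simp only [dotProduct]; fun_prop) hLT hT (le_trans ?_ hpsi)
    exact le_iSup₂ (f := fun (v : Fin K → ℝ) (_ : l2norm v = 1) =>
      psi2Norm P fun ω => v ⬝ᵥ Zt ω) v hv
  have h2 : (fun ω => v ⬝ᵥ Zt ω) =ᵐ[P] fun ω => v ⬝ᵥ M.whitened S none ω := by
    filter_upwards [hZt] with ω hω
    rw [whitened, hω, Matrix.mulVec_mulVec, Matrix.nonsing_inv_mul _ hS, Matrix.one_mulVec]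
  have hid : IdentDistrib (fun ω => v ⬝ᵥ M.whitened S i ω)
      (fun ω => v ⬝ᵥ M.whitened S none ω) P P :=
    (M.identDistrib_Z i).comp (u := fun x => v ⬝ᵥ (S⁻¹ *ᵥ x))
      (by simp only [Matrix.mulVec, dotProduct]; fun_prop)
  exact (h1.congr_identDistrib (IdentDistrib.of_ae_eq
    (by simp only [dotProduct]; fun_prop) h2)).congr_identDistrib hid.symm

/-! ### Expectation over the training noise -/

/-- With the design frozen, the excess risk is a sum of squares of linear forms in noise with
covariance `σ_ε² I`, so its mean is exact. -/
theorem integrable_riskResampled_and_noiseMeanRisk [IsProbabilityMeasure P]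
    (hE : M.covE = 0) (hM : M.FullRank)
    (hSS : S * S = M.covZ) (hsymm : Sᵀ = S) {ω : Ω} (hω : ∀ i, M.E i ω = 0)
    (hV : ∀ v, M.whitenedData S ω *ᵥ v = 0 → v = 0) :
    Integrable (M.riskResampled ω) P ∧ M.noiseMeanRisk ω = M.noiseVar *
      ∑ k, leftInv (M.whitenedData S ω) k ⬝ᵥ leftInv (M.whitenedData S ω) k + M.noiseVar := by
  have h1 : M.riskResampled ω = fun ω' =>
      ∑ k, (leftInv (M.whitenedData S ω) k ⬝ᵥ M.dataε ω') ^ 2 + M.noiseVar :=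
    funext fun ω' => M.risk_minNormLS hE hM hSS hsymm hω hV _
  have h2 : ∀ k, Integrable
      (fun ω' => (leftInv (M.whitenedData S ω) k ⬝ᵥ M.dataε ω') ^ 2) P := fun k =>
    (memLp_dotProduct (W := M.dataε) (fun i => M.memLp_ε_some (some i)) _).integrable_sq
  have h3 := integrable_finsetSum Finset.univ fun k _ => h2 k
  refine ⟨h1 ▸ h3.add (integrable_const _), ?_⟩
  rw [noiseMeanRisk, h1, integral_add h3 (integrable_const _),
    integral_finsetSum _ fun k _ => h2 k]
  simp [integral_dotProduct_dataε_sq, Finset.mul_sum]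

end Model

namespace Model

variable {Ω : Type*} [MeasurableSpace Ω] {P : Measure Ω} {n p K : ℕ}
  (M : Model P n p K) {S : Matrix (Fin K) (Fin K) ℝ}

/-! ### Risk bounds -/

theorem rank_dataZ (hM : M.FullRank) (hSS : S * S = M.covZ) (hsymm : Sᵀ = S) {ω : Ω}
    (hV : ∀ v, M.whitenedData S ω *ᵥ v = 0 → v = 0) : (M.dataZ ω).rank = K := by
  have hS := M.isUnit_sqrt hM hSS
  rw [rank_eq_iff_forall_mulVec_eq_zero]
  intro v hv
  rw [M.dataZ_eq_whitenedData_mul hS hsymm, ← Matrix.mulVec_mulVec] at hv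
  exact Matrix.mulVec_injective_iff_isUnit.2 ((Matrix.isUnit_iff_isUnit_det S).2 hS)
    ((hV _ hv).trans (Matrix.mulVec_zero S).symm)

variable [IsProbabilityMeasure P]

/-- The risk bounds hold whenever the whitened design is well conditioned and the noise is not
atypically large in the relevant directions. -/
theorem risk_bounds_of_good (hE : M.covE = 0) (hM : M.FullRank) (hSS : S * S = M.covZ)
    (hsymm : Sᵀ = S) {T : ℝ} (hT : 0 < T) (hn : (0 : ℝ) < n) {ω : Ω} (hω : ∀ i, M.E i ω = 0)
    (hlo : ∀ v, (n / 16 : ℝ) * (v ⬝ᵥ v) ≤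
      (M.whitenedData S ω *ᵥ v) ⬝ᵥ (M.whitenedData S ω *ᵥ v))
    (hhi : ∀ v, (M.whitenedData S ω *ᵥ v) ⬝ᵥ (M.whitenedData S ω *ᵥ v) ≤
      8 * T ^ 2 * n * (v ⬝ᵥ v))
    (hnoise : ∀ k, leftInv (M.whitenedData S ω) k ⬝ᵥ leftInv (M.whitenedData S ω) k ≤ 16 / n →
      (leftInv (M.whitenedData S ω) k ⬝ᵥ M.dataε ω) ^ 2 ≤
        4 * T ^ 2 * M.noiseVar * (16 / n) * (2 * Real.log n)) :
    (M.dataZ ω).rank = K ∧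
      M.risk (M.αHat ω) - M.noiseVar ≤
        128 * T ^ 2 * (M.noiseVar * ((K : ℝ) * Real.log (n : ℝ) / (n : ℝ))) ∧
      Integrable (M.riskResampled ω) P ∧
      M.noiseMeanRisk ω - M.noiseVar ≥
        1 / (8 * T ^ 2) * (M.noiseVar * ((K : ℝ) / (n : ℝ))) := by
  have hn16 : (0 : ℝ) < n / 16 := by positivity
  have hV : ∀ v, M.whitenedData S ω *ᵥ v = 0 → v = 0 := fun v =>
    mulVec_eq_zero_of_bound hn16 hlo
  obtain ⟨hint, hmean⟩ := M.integrable_riskResampled_and_noiseMeanRisk hE hM hSS hsymm hω hV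
  refine ⟨M.rank_dataZ hM hSS hsymm hV, ?_, hint, ?_⟩
  · have h1 : M.risk (M.αHat ω) =
        ∑ k, (leftInv (M.whitenedData S ω) k ⬝ᵥ M.dataε ω) ^ 2 + M.noiseVar :=
      M.risk_minNormLS hE hM hSS hsymm hω hV (M.dataε ω)
    rw [h1, add_sub_cancel_right]
    -- The constant `128` is `4 * 16 * 2`.
    calc _ ≤ ∑ _k : Fin K, 4 * T ^ 2 * M.noiseVar * (16 / n) * (2 * Real.log n) :=
          Finset.sum_le_sum fun k _ => hnoise k
            ((leftInv_row_le hn16 hlo k).trans_eq (one_div_div _ _))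
      _ = _ := by
          rw [Finset.sum_const, Finset.card_univ, Fintype.card_fin, nsmul_eq_mul]
          ring
  · have h1 := le_sum_leftInv hn16 (b := 8 * T ^ 2 * n) (by positivity) hlo hhi
    rw [Fintype.card_fin] at h1
    rw [hmean, add_sub_cancel_right]
    calc 1 / (8 * T ^ 2) * (M.noiseVar * ((K : ℝ) / (n : ℝ)))
        = M.noiseVar * (K / (8 * T ^ 2 * n)) := by field_simp
      _ ≤ _ := mul_le_mul_of_nonneg_left h1 M.noiseVar_nonneg

/-- Failure forces nonzero feature noise (probability `0`), an ill-conditioned design (`c / n`), or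
one of `K ≤ n` large noise coordinates (`2 / n²` each). -/
theorem measureReal_bad_le {L T C c : ℝ} (hE : M.covE = 0) (hM : M.FullRank) (hT : 0 < T)
    (hLT : L < T) (hsub : M.IsSubGaussian L) (hC : 1 ≤ C) (hn : C * (K : ℝ) < (n : ℝ))
    (H : ∀ V : Fin n → Ω → Fin K → ℝ, (∀ i, Measurable (V i)) → iIndepFun V P →
      (∀ i (v : Fin K → ℝ), l2norm v = 1 → ExpSq P (fun ω => v ⬝ᵥ V i ω) T) →
      (∀ i (v : Fin K → ℝ), l2norm v = 1 → ∫ ω, (v ⬝ᵥ V i ω) ^ 2 ∂P = 1) →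
      C * (K : ℝ) < (n : ℝ) →
      P.real {ω | ¬ ∀ v : Fin K → ℝ,
        (n / 16 : ℝ) * (v ⬝ᵥ v) ≤
            (Matrix.of (fun i => V i ω) *ᵥ v) ⬝ᵥ (Matrix.of (fun i => V i ω) *ᵥ v) ∧
          (Matrix.of (fun i => V i ω) *ᵥ v) ⬝ᵥ (Matrix.of (fun i => V i ω) *ᵥ v) ≤
            8 * T ^ 2 * n * (v ⬝ᵥ v)} ≤ c / n) :
    P.real {ω | ¬ ((M.dataZ ω).rank = K ∧
      M.risk (M.αHat ω) - M.noiseVar ≤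
        128 * T ^ 2 * (M.noiseVar * ((K : ℝ) * Real.log (n : ℝ) / (n : ℝ))) ∧
      Integrable (M.riskResampled ω) P ∧
      M.noiseMeanRisk ω - M.noiseVar ≥
        1 / (8 * T ^ 2) * (M.noiseVar * ((K : ℝ) / (n : ℝ))))} ≤ (c + 2) / n := by
  have hn0 : (0 : ℝ) < n := lt_of_le_of_lt (by positivity) hn
  have hKn : (K : ℝ) ≤ n := by nlinarith [(Nat.cast_nonneg K : (0 : ℝ) ≤ K)]
  have hlog : 0 ≤ Real.log n := Real.log_natCast_nonneg n
  obtain ⟨S, Zt, hpsd, hSS, hZtm, hZt, -, hpsi⟩ := hsub.1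
  have hsymm : Sᵀ = S := by
    simpa [Matrix.conjTranspose_eq_transpose_of_trivial] using hpsd.isHermitian.eq
  have hS := M.isUnit_sqrt hM hSS
  set bad₁ : Set Ω := {ω | ¬ ∀ i, M.E i ω = 0}
  set bad₂ : Set Ω := {ω | ¬ ∀ v : Fin K → ℝ,
    (n / 16 : ℝ) * (v ⬝ᵥ v) ≤ (M.whitenedData S ω *ᵥ v) ⬝ᵥ (M.whitenedData S ω *ᵥ v) ∧
      (M.whitenedData S ω *ᵥ v) ⬝ᵥ (M.whitenedData S ω *ᵥ v) ≤ 8 * T ^ 2 * n * (v ⬝ᵥ v)}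
  set bad₃ : Fin K → Set Ω := fun k =>
    {ω | leftInv (M.whitenedData S ω) k ⬝ᵥ leftInv (M.whitenedData S ω) k ≤ 16 / n ∧
      4 * T ^ 2 * M.noiseVar * (16 / n) * (2 * Real.log n) <
        (leftInv (M.whitenedData S ω) k ⬝ᵥ M.dataε ω) ^ 2}
  have h₁ : P.real bad₁ = 0 := by
    rw [Measure.real, ae_iff.1 (M.ae_E_eq_zero hE), ENNReal.toReal_zero]
  have h₂ : P.real bad₂ ≤ c / n :=
    H (fun i => M.whitened S (some i)) (fun i => M.measurable_whitened S _)
      (M.iIndepFun_whitened S) (fun i v hv => M.whitened_expSq hS hT hLT hZt hZtm hpsi _ hv)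
      (fun i v hv => M.whitened_isotropic hM hSS hsymm _ hv) hn
  have h₃ : ∀ k, P.real (bad₃ k) ≤ 2 / (n : ℝ) ^ 2 := fun k => by
    -- The level `2 log n` makes each tail of order `n⁻²`, which survives a union over at most `n`
    -- coordinates.
    have := M.measureReal_leftInv_dataε_le hsub hT hLT S (d := 16 / n)
      (x := 2 * Real.log n) (by positivity) k
    have hexp : Real.exp (-(2 * Real.log n)) = ((n : ℝ) ^ 2)⁻¹ := by
      rw [Real.exp_neg, two_mul, Real.exp_add, Real.exp_log hn0, sq]
    rwa [hexp, ← div_eq_mul_inv] at this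
  calc _ ≤ P.real (bad₁ ∪ (bad₂ ∪ ⋃ k, bad₃ k)) := by
        refine measureReal_mono fun ω hω => ?_
        by_contra hcon
        simp only [Set.mem_union, Set.mem_iUnion, not_or, not_exists] at hcon
        obtain ⟨g₁, g₂, g₃⟩ := hcon
        have g₁ := not_not.1 g₁
        have g₂ := not_not.1 g₂
        exact hω (M.risk_bounds_of_good hE hM hSS hsymm hT hn0 g₁ (fun v => (g₂ v).1)
          (fun v => (g₂ v).2) fun k hk => not_lt.1 fun hlt => g₃ k ⟨hk, hlt⟩)
    _ ≤ P.real bad₁ + (P.real bad₂ + ∑ k, P.real (bad₃ k)) :=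
        (measureReal_union_le _ _).trans (by
          gcongr
          refine (measureReal_union_le _ _).trans ?_
          gcongr
          exact measureReal_iUnion_fintype_le _)
    _ ≤ 0 + (c / n + ∑ _k : Fin K, 2 / (n : ℝ) ^ 2) := by
        gcongr
        · exact h₁.le
        · exact h₃ _
    _ = c / n + K * (2 / (n : ℝ) ^ 2) := by
        rw [Finset.sum_const, Finset.card_univ, Fintype.card_fin, nsmul_eq_mul, zero_add]
    _ ≤ c / n + n * (2 / (n : ℝ) ^ 2) := by gcongr
    _ = (c + 2) / n := by field_simp

end Model
end FactorRegression

/-! ### Choice of the constants and conclusion -/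

open FactorRegression in
theorem mainTheorem3 :
    -- Part 1: equality of the realizable and the oracle prediction, and of their risks
    (∀ {Ω : Type*} [MeasurableSpace Ω] (P : Measure Ω) [IsProbabilityMeasure P] (n p K : ℕ)
      (M : Model P n p K), M.covE = 0 → M.FullRank →
      ∀ᵐ ω ∂P, (M.dataZ ω).rank = K →
        M.X none ω ⬝ᵥ M.αHat ω = M.Z none ω ⬝ᵥ M.βHat ω ∧
        M.risk (M.αHat ω) = ∫ ω', (M.Z none ω' ⬝ᵥ M.βHat ω - M.y none ω') ^ 2 ∂P) ∧
    -- Part 2: the constants depend only on the bound `L` on the sub-Gaussian norms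
    (∀ L : ℝ, 0 < L → ∃ C c c₁ c₂ : ℝ, 0 < C ∧ 0 < c ∧ 0 < c₁ ∧ 0 < c₂ ∧
      ∀ {Ω : Type*} [MeasurableSpace Ω] (P : Measure Ω) [IsProbabilityMeasure P] (n p K : ℕ)
        (M : Model P n p K), M.covE = 0 → M.FullRank → M.IsSubGaussian L →
        C * (K : ℝ) < (n : ℝ) →
        -- the (outer) probability that one of the claims fails is at most `c / n`
        P.real {ω | ¬ ((M.dataZ ω).rank = K ∧
            M.risk (M.αHat ω) - M.noiseVar ≤
              c₁ * (M.noiseVar * ((K : ℝ) * Real.log (n : ℝ) / (n : ℝ))) ∧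
            Integrable (M.riskResampled ω) P ∧
            M.noiseMeanRisk ω - M.noiseVar ≥
              c₂ * (M.noiseVar * ((K : ℝ) / (n : ℝ))))} ≤ c / (n : ℝ)) := by
  refine ⟨fun P _ n p K M hE hM => M.prediction_eq hE hM, fun L hL => ?_⟩
  -- The scale is `T = 2 L`; any fixed multiple of `L` strictly above `L` would serve.
  have hT : 0 < 2 * L := by positivity
  have hLT : L < 2 * L := by linarith
  obtain ⟨C, c, hC, hc, H⟩ := exists_random_matrix_bounds hT
  refine ⟨C, c + 2, 128 * (2 * L) ^ 2, 1 / (8 * (2 * L) ^ 2), by positivity, by positivity,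
    by positivity, by positivity, ?_⟩
  intro Ω _ P _ n p K M hE hM hsub hn
  exact M.measureReal_bad_le hE hM hT hLT hsub hC hn (H P n K)
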